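/- Let $M$ be a smooth manifold (finite-dimensional, Hausdorff, second countable, without boundary). A *graded bundle* over $M$ is a smooth manifold $F$ with a smooth action $\mathrm h:\mathbb R\times F\to F$ of the multiplicative monoid $(\mathbb R,\cdot)$, together with an identification of $M$ with $\mathrm h_0(F)$; write $\tau=\mathrm h_0:F\to M$ for the resulting projection. For a smooth real vector bundle $A\to M$ and a smooth map $\tau:F\to M$, let $\tau^*\Pi A=\Pi A\times_M F$ be the supermanifold whose algebra of functions is $C^\infty(\tau^*\Pi A)=\Gamma(F,\Lambda^\bullet\tau^*A^*)$, with parity given by the exterior degree mod 2; $\Pi A$ itself is the case $F=M$, $\tau=\mathrm{id}$. Odd vector fields are odd derivations of this superalgebra. For $t\in\mathbb R$, $\mathrm l_t^*$ multiplies the component of exterior degree $p$ by $t^p$, and for a graded bundle $\mathrm h_t^*$ is the pullback along $\mathrm h_t$, which preserves the fibres of $\tau$. A *Lie algebroid* structure on $A$ is an odd vector field $\mathrm d_A$ on $\Pi A$ with $\mathrm d_A^2=0$ and $\mathrm l_t^*\circ\mathrm d_A=t\,\mathrm d_A\circ\mathrm l_t^*$ for all $t\in\mathbb R$. A *weighted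 $A$-connection* on a graded bundle $F$ over $M$ is an odd vector field $\nabla$ on $\Pi A\times_M F$ of bi-weight $(0,1)$, i.e. $$\mathrm h_t^*\circ\nabla=\nabla\circ\mathrm h_t^*,\qquad \mathrm l_t^*\circ\nabla=t\,\nabla\circ\mathrm l_t^*\qquad\text{for all }t\in\mathbb R,$$ that projects to $\mathrm d_A$, i.e. $\nabla\circ \mathrm p^*=\mathrm p^*\circ\mathrm d_A$ for the projection $\mathrm p:\Pi A\times_M F\to\Pi A$. **Theorem.** For every graded bundle $F$ over $M$ and every Lie algebroid $(\Pi A,\mathrm d_A)$ over the same base $M$, the set of weighted $A$-connections on $F$ is non-empty. -/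

import Mathlib

open scoped Manifold ContDiff

noncomputable section

namespace GradedConnection

/-! ### Functions on the pullback of an antivector bundle

For a smooth vector bundle `A → M` the supermanifold `ΠA` has as its algebra of (global) functions
the sections of the exterior bundle `Λ A*`.  For a smooth map `τ : F → M` the supermanifold
`τ* ΠA = ΠA ×_M F` has as its functions the sections over `F` of `τ* Λ A*`.  The supermanifold `ΠA`
itself is the case `τ = id`. -/

section Functions

variable {M : Type*} {F : Type*} (A : M → Type*)
  [∀ x, AddCommGroup (A x)] [∀ x, Module ℝ (A x)]

/-- Not necessarily smooth functions on `τ* ΠA`: to each `x : M` and each point `q` of `F` over `x`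
one assigns an element of the exterior algebra `Λ (A x)*`.  The algebra structure is pointwise. -/
abbrev PreFunction (τ : F → M) : Type _ :=
  (x : M) → {q : F // τ q = x} → ExteriorAlgebra ℝ (Module.Dual ℝ (A x))

variable (EF : Type*) [NormedAddCommGroup EF] [NormedSpace ℝ EF]
  [TopologicalSpace F] [ChartedSpace EF F]
  (V : Type*) [NormedAddCommGroup V] [NormedSpace ℝ V]
  [TopologicalSpace M] [∀ x, TopologicalSpace (A x)] [TopologicalSpace (Bundle.TotalSpace V A)]
  [FiberBundle V A] [VectorBundle ℝ V A]

variable {A} in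
/-- The expression of `f` in the local trivialization of `A` at `τ q₀`, as a function of `q : F`
with values in the fixed vector space `Λ V*` (meaningful for `q` near `q₀`). -/
def localRep {τ : F → M} (f : PreFunction A τ) (q₀ q : F) :
    ExteriorAlgebra ℝ (Module.Dual ℝ V) :=
  ExteriorAlgebra.map (((trivializationAt V A (τ q₀)).symmₗ ℝ (τ q)).dualMap) (f (τ q) ⟨q, rfl⟩)

variable {A} in
/-- `f` is smooth if all the components of its local expressions are smooth functions on `F`. -/
def IsSmooth {τ : F → M} (f : PreFunction A τ) : Prop :=
  ∀ (q₀ : F) (ℓ : Module.Dual ℝ (ExteriorAlgebra ℝ (Module.Dual ℝ V))),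
    ContMDiffAt 𝓘(ℝ, EF) 𝓘(ℝ, ℝ) ∞ (fun q => ℓ (localRep V f q₀ q)) q₀

instance exteriorAlgebra_finite (W : Type*) [AddCommGroup W] [Module ℝ W]
    [FiniteDimensional ℝ W] : FiniteDimensional ℝ (ExteriorAlgebra ℝ W) :=
  Module.Finite.of_basis (Module.finBasis ℝ W).ExteriorAlgebra

variable {A EF V} in
theorem IsSmooth.mul [FiniteDimensional ℝ V] {τ : F → M} {f g : PreFunction A τ}
    (hf : IsSmooth EF V f) (hg : IsSmooth EF V g) : IsSmooth EF V (f * g) := by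
  intro q₀ ℓ
  let b := Module.finBasis ℝ (ExteriorAlgebra ℝ (Module.Dual ℝ V))
  have h : (fun q => ℓ (localRep V (f * g) q₀ q)) = fun q =>
      ∑ i, ∑ j, (b.coord i (localRep V f q₀ q) * b.coord j (localRep V g q₀ q)) *
        ℓ (b i * b j) := by
    funext q
    have e : localRep V (f * g) q₀ q = localRep V f q₀ q * localRep V g q₀ q := by
      simp [localRep]
    rw [e]
    have mul_eq : ∀ v w : ExteriorAlgebra ℝ (Module.Dual ℝ V),
        ℓ (v * w) = ∑ i, ∑ j, (b.coord i v * b.coord j w) * ℓ (b i * b j) := by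
      intro v w
      have hv := congrArg ℓ (congrArg₂ (· * ·) (b.sum_repr v) (b.sum_repr w))
      rw [← hv]
      simp only [Finset.sum_mul_sum, map_sum, smul_mul_smul_comm, map_smul, smul_eq_mul,
        Module.Basis.coord_apply]
    exact mul_eq _ _
  rw [h]
  refine ContMDiffAt.sum fun i _ => ContMDiffAt.sum fun j _ => ?_
  exact ((hf q₀ (b.coord i)).mul (hg q₀ (b.coord j))).mul contMDiffAt_const

/-- The algebra `C^∞(τ* ΠA)` of functions on the supermanifold `τ* ΠA = ΠA ×_M F`. -/
def Functions [FiniteDimensional ℝ V] (τ : F → M) : Subalgebra ℝ (PreFunction A τ) where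
  carrier := {f | IsSmooth EF V f}
  mul_mem' := IsSmooth.mul
  add_mem' {f g} hf hg := fun q₀ ℓ => by
    simpa [localRep] using! (hf q₀ ℓ).add (hg q₀ ℓ)
  algebraMap_mem' r := fun q₀ ℓ => by
    have h : (fun q => ℓ (localRep V (algebraMap ℝ (PreFunction A τ) r) q₀ q)) =
        fun _ => ℓ (algebraMap ℝ _ r) := by
      funext q
      simp only [localRep, Pi.algebraMap_apply, AlgHom.commutes]
    rw [h]
    exact contMDiffAt_const

variable {A EF V} [FiniteDimensional ℝ V]

/-- The homogeneity structure `l` of the vector bundle `A`, acting on functions: `l_t*` multiplies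
the fibre coordinates `ξ` by `t`, i.e. the component of exterior degree `p` by `t ^ p`. -/
def fibreScale {τ : F → M} (t : ℝ) : Functions A EF V τ →ₐ[ℝ] Functions A EF V τ where
  toFun f := ⟨fun x q => ExteriorAlgebra.map (t • LinearMap.id) (f.1 x q), fun q₀ ℓ => by
    have h := f.2 q₀ (ℓ ∘ₗ (ExteriorAlgebra.map
      (t • (LinearMap.id : Module.Dual ℝ V →ₗ[ℝ] Module.Dual ℝ V))).toLinearMap)
    refine h.congr_of_eventuallyEq (Filter.Eventually.of_forall fun q => ?_)
    simp only [localRep, LinearMap.comp_apply, AlgHom.toLinearMap_apply]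
    simp only [← AlgHom.comp_apply, ExteriorAlgebra.map_comp_map]
    congr 3⟩
  map_one' := by ext x q; simp
  map_mul' f g := by ext x q; simp
  map_zero' := by ext x q; simp
  map_add' f g := by ext x q; simp
  commutes' r := Subtype.ext (by
    funext x q
    simp only [Subalgebra.coe_algebraMap, Pi.algebraMap_apply, AlgHom.commutes])

/-- The Grassmann parity involution: `f ↦ f` for `f` even (all components of even exterior degree)
and `f ↦ -f` for `f` odd. -/
def parity {τ : F → M} : Functions A EF V τ →ₐ[ℝ] Functions A EF V τ := fibreScale (-1)

/-- A smooth map `φ : F → F'` over `M` induces a morphism `τ* ΠA → τ'* ΠA` that is the identity on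
the fibres of `A`; this is the induced pullback of functions. -/
def pullback {F' : Type*} {EF' : Type*} [NormedAddCommGroup EF'] [NormedSpace ℝ EF']
    [TopologicalSpace F'] [ChartedSpace EF' F'] {τ : F → M} {τ' : F' → M} (φ : F → F')
    (hφ : ContMDiff 𝓘(ℝ, EF) 𝓘(ℝ, EF') ∞ φ) (h : ∀ q, τ' (φ q) = τ q) :
    Functions A EF' V τ' →ₐ[ℝ] Functions A EF V τ where
  toFun f := ⟨fun x q => f.1 x ⟨φ q.1, (h q.1).trans q.2⟩, fun q₀ ℓ => by
    refine ((f.2 (φ q₀) ℓ).comp q₀ (hφ q₀)).congr_of_eventuallyEq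
      (Filter.Eventually.of_forall fun q => ?_)
    have key : ∀ (x y y' : M) (hx : τ' (φ q) = x), y' = y →
        ExteriorAlgebra.map (((trivializationAt V A y).symmₗ ℝ x).dualMap) (f.1 x ⟨φ q, hx⟩) =
        ExteriorAlgebra.map (((trivializationAt V A y').symmₗ ℝ (τ' (φ q))).dualMap)
          (f.1 (τ' (φ q)) ⟨φ q, rfl⟩) := by
      rintro x y y' rfl rfl
      rfl
    exact congrArg ℓ (key _ _ _ (h q) (h q₀))⟩
  map_one' := rfl
  map_mul' _ _ := rfl
  map_zero' := rfl
  map_add' _ _ := rfl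
  commutes' _ := rfl

variable (A EF V) in
/-- Odd vector fields on `τ* ΠA`: odd derivations of the superalgebra of functions. -/
structure OddVectorField (τ : F → M) where
  /-- the derivation, as a linear operator on functions -/
  toLinearMap : Functions A EF V τ →ₗ[ℝ] Functions A EF V τ
  /-- even functions are mapped to odd ones and odd functions to even ones -/
  odd : ∀ f, toLinearMap (parity f) = -parity (toLinearMap f)
  /-- the graded Leibniz rule `D (f g) = (D f) g + (-1) ^ |f| f (D g)` -/
  leibniz : ∀ f g, toLinearMap (f * g) = toLinearMap f * g + parity f * toLinearMap g

instance {τ : F → M} : CoeFun (OddVectorField A EF V τ)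
    (fun _ => Functions A EF V τ → Functions A EF V τ) := ⟨fun D => D.toLinearMap⟩

end Functions

section LieAlgebroid

variable (EM : Type*) [NormedAddCommGroup EM] [NormedSpace ℝ EM]
  {M : Type*} [TopologicalSpace M] [ChartedSpace EM M]
  (V : Type*) [NormedAddCommGroup V] [NormedSpace ℝ V] [FiniteDimensional ℝ V]
  (A : M → Type*) [∀ x, AddCommGroup (A x)] [∀ x, Module ℝ (A x)]
  [∀ x, TopologicalSpace (A x)] [TopologicalSpace (Bundle.TotalSpace V A)]
  [FiberBundle V A] [VectorBundle ℝ V A]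

/-- A Lie algebroid structure on the vector bundle `A → M`: a homological vector field `d_A` of
weight one on `ΠA`. -/
structure LieAlgebroid where
  /-- the homological vector field -/
  d : OddVectorField A EM V (id : M → M)
  /-- `d_A` has weight one: `l_t* ∘ d_A = t d_A ∘ l_t*` -/
  weight_one : ∀ (t : ℝ) (f : Functions A EM V (id : M → M)),
    fibreScale t (d f) = t • d (fibreScale t f)
  /-- `d_A` squares to zero -/
  homological : ∀ f : Functions A EM V (id : M → M), d (d f) = 0

end LieAlgebroid

section GradedBundle

variable (EM : Type*) [NormedAddCommGroup EM] [NormedSpace ℝ EM]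
  (M : Type*) [TopologicalSpace M] [ChartedSpace EM M]
  (EF : Type*) [NormedAddCommGroup EF] [NormedSpace ℝ EF]
  (F : Type*) [TopologicalSpace F] [ChartedSpace EF F]

/-- A graded bundle with total space `F` and base `M`: a homogeneity structure on `F`, that is, a
smooth action `h` of the monoid `(ℝ, ·)`, together with an identification of `M` with the
submanifold `F₀ = h₀(F)` by which `h₀` becomes the projection `τ : F → M`. -/
structure GradedBundle where
  /-- the homogeneity structure `h` -/
  act : ℝ → F → F
  act_one : ∀ q, act 1 q = q
  act_mul : ∀ s t q, act (s * t) q = act s (act t q)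
  contMDiff_act :
    ContMDiff (𝓘(ℝ, ℝ).prod 𝓘(ℝ, EF)) 𝓘(ℝ, EF) ∞ (fun p : ℝ × F => act p.1 p.2)
  /-- the projection `τ` -/
  proj : F → M
  contMDiff_proj : ContMDiff 𝓘(ℝ, EF) 𝓘(ℝ, EM) ∞ proj
  /-- the inclusion of the base as `h₀(F)` -/
  incl : M → F
  contMDiff_incl : ContMDiff 𝓘(ℝ, EM) 𝓘(ℝ, EF) ∞ incl
  proj_incl : ∀ x, proj (incl x) = x
  incl_proj : ∀ q, incl (proj q) = act 0 q

variable {EM M EF F}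

theorem GradedBundle.proj_act (B : GradedBundle EM M EF F) (t : ℝ) (q : F) :
    B.proj (B.act t q) = B.proj q := by
  rw [← B.proj_incl (B.proj (B.act t q)), B.incl_proj, ← B.act_mul, zero_mul, ← B.incl_proj,
    B.proj_incl]

theorem GradedBundle.contMDiff_act_apply (B : GradedBundle EM M EF F) (t : ℝ) :
    ContMDiff 𝓘(ℝ, EF) 𝓘(ℝ, EF) ∞ (B.act t) :=
  B.contMDiff_act.comp (contMDiff_const.prodMk contMDiff_id)

variable {V : Type*} [NormedAddCommGroup V] [NormedSpace ℝ V] [FiniteDimensional ℝ V]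
  {A : M → Type*} [∀ x, AddCommGroup (A x)] [∀ x, Module ℝ (A x)]
  [∀ x, TopologicalSpace (A x)] [TopologicalSpace (Bundle.TotalSpace V A)]
  [FiberBundle V A] [VectorBundle ℝ V A]

/-- The homogeneity structure `h` on `τ* ΠA`, acting on functions: `h_t*`. -/
def baseScale (B : GradedBundle EM M EF F) (t : ℝ) :
    Functions A EF V B.proj →ₐ[ℝ] Functions A EF V B.proj :=
  pullback (B.act t) (B.contMDiff_act_apply t) (B.proj_act t)

/-- Pullback of functions along the projection `p : τ* ΠA → ΠA`. -/
def projPullback (B : GradedBundle EM M EF F) :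
    Functions A EM V (id : M → M) →ₐ[ℝ] Functions A EF V B.proj :=
  pullback B.proj B.contMDiff_proj (fun _ => rfl)

/-- The set of weighted `A`-connections on a graded bundle: the odd vector fields on `τ* ΠA` of
bi-weight `(0, 1)` with respect to the homogeneity structures `(h, l)` that project to `d_A`. -/
def weightedConnections (B : GradedBundle EM M EF F) (L : LieAlgebroid EM V A) :
    Set (OddVectorField A EF V B.proj) :=
  {D | (∀ (t : ℝ) (f : Functions A EF V B.proj), baseScale B t (D f) = D (baseScale B t f)) ∧
    (∀ (t : ℝ) (f : Functions A EF V B.proj), fibreScale t (D f) = t • D (fibreScale t f)) ∧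
    (∀ f : Functions A EM V (id : M → M), D (projPullback B f) = projPullback B (L.d f))}

end GradedBundle

end GradedConnection

end

noncomputable section

namespace GradedConnection

/-! Connections can be built locally over `M` and glued by a partition of unity on `M`: the defining
conditions are affine, and functions on `M` are invariant under `h` and have exterior degree 0.

Near the fibre over a point `x₀`, the action is linearized: there is a global smooth `Φ : F → EF`
with `Φ ∘ h_t = Λ_t ∘ Φ` and invertible derivative at `incl x₀` (`exists_linearization`). It is
assembled from the Taylor coefficients at `t = 0` of `t ↦ h_t q`, read in a chart; these are
homogeneous, and are projected to the weight spaces of the representation `t ↦ d(h_t)` at the fixed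
point. Contracting orbits to the zero section shows that `dΦ` is invertible along whole fibres over
a neighbourhood of `x₀` (`isInvertible_der_of_incl`). Pulling `d(Φ ∘ incl)` back through `dΦ` yields
a lift `H_q` of tangent vectors at `τ q` to `q`; it splits `dτ` and is equivariant under `h`.

To differentiate `f` at `q`, take a function `s` on `ΠA` whose value and derivative at `τ q` are the
value of `f` and its derivative along `H_q`, and set `(∇f)(q) = (d_A s)(τ q)`. By Hadamard's lemma
`d_A` is of first order, so the choice of `s` does not matter (`JetRel.evalAt_eq`). Linearity, the
Leibniz rule, both weight conditions and projectability then follow by exhibiting two admissible `s`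
for the same jet. Smoothness comes from an explicit `s` with coefficients affine in `Φ ∘ incl`
(`evalAt_jetSection`). -/

/-! ### Hadamard's lemma and point derivations of smooth functions -/

open MeasureTheory in
/-- **Hadamard's lemma** on a vector space, to first order. -/
theorem exists_contDiff_eq_add_apply_sub {E : Type*} [NormedAddCommGroup E] [NormedSpace ℝ E]
    {a : E → ℝ} (ha : ContDiff ℝ ∞ a) (y₀ : E) :
    ∃ h : E → (E →L[ℝ] ℝ), ContDiff ℝ ∞ h ∧ h y₀ = fderiv ℝ a y₀ ∧
      ∀ y, a y = a y₀ + h y (y - y₀) := by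
  have ha' : ContDiff ℝ ∞ (fderiv ℝ a) := ha.fderiv_right (m := ∞) le_rfl
  -- The integral of the derivative over `t ∈ [0, 1]` is written as a convolution at `0`, which is
  -- smooth in parameters provided the second factor has compact support in `t`; hence the cut-off
  -- `β`, equal to 1 on `[-2, 2]`. The convolution evaluates `g y` at `-t`, which accounts for the
  -- minus sign in `g`.
  let β : ContDiffBump (0 : ℝ) := ⟨2, 3, by norm_num, by norm_num⟩
  let f : ℝ → ℝ := Set.indicator (Set.Icc 0 1) 1
  let g : E → ℝ → (E →L[ℝ] ℝ) := fun y t => β t • fderiv ℝ a (y₀ - t • (y - y₀))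
  have hf : LocallyIntegrable f volume := by
    apply Integrable.locallyIntegrable
    exact (integrable_indicator_iff measurableSet_Icc).2 (by simp [Pi.one_def])
  have hg : ContDiff ℝ ∞ (↿g) := by
    have h1 : ContDiff ℝ ∞ (fun p : E × ℝ => β p.2) := β.contDiff.comp contDiff_snd
    have h2 : ContDiff ℝ ∞ (fun p : E × ℝ => fderiv ℝ a (y₀ - p.2 • (p.1 - y₀))) :=
      ha'.comp (contDiff_const.sub (contDiff_snd.smul (contDiff_fst.sub contDiff_const)))
    exact h1.smul h2
  let h : E → (E →L[ℝ] ℝ) := fun y =>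
    (convolution f (g y) (ContinuousLinearMap.lsmul ℝ ℝ) volume) 0
  have hint : ∀ y, h y = ∫ t in (0 : ℝ)..1, fderiv ℝ a (y₀ + t • (y - y₀)) := by
    intro y
    rw [intervalIntegral.integral_of_le zero_le_one, ← integral_Icc_eq_integral_Ioc,
      ← integral_indicator measurableSet_Icc]
    refine integral_congr_ae (Filter.Eventually.of_forall fun t => ?_)
    by_cases ht : t ∈ Set.Icc (0 : ℝ) 1
    · have : β (-t) = 1 := β.one_of_mem_closedBall (by
        simp only [mem_closedBall_zero_iff, norm_neg, Real.norm_eq_abs, abs_of_nonneg ht.1]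
        exact ht.2.trans (by norm_num [β]))
      simp [f, g, ht, this]
    · simp [f, ht]
  have hh : ContDiff ℝ ∞ h := by
    rw [← contDiffOn_univ]
    refine contDiffOn_convolution_right_with_param_comp (n := ⊤) (ContinuousLinearMap.lsmul ℝ ℝ)
      (contDiffOn_const (c := (0 : ℝ))) isOpen_univ (isCompact_closedBall (0 : ℝ) 3) ?_ hf
      hg.contDiffOn
    intro p t _ ht
    have : β t = 0 := β.zero_of_le_dist (by
      simp only [Metric.mem_closedBall, not_le] at ht
      exact ht.le)
    simp [g, this]
  refine ⟨h, hh, by simp [hint], fun y => ?_⟩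
  have hcont : Continuous fun t : ℝ => fderiv ℝ a (y₀ + t • (y - y₀)) :=
    ha'.continuous.comp (by fun_prop)
  have key : ∫ t in (0 : ℝ)..1, fderiv ℝ a (y₀ + t • (y - y₀)) (y - y₀) =
      a (y₀ + (1 : ℝ) • (y - y₀)) - a (y₀ + (0 : ℝ) • (y - y₀)) := by
    refine intervalIntegral.integral_eq_sub_of_hasDerivAt
      (f := fun t : ℝ => a (y₀ + t • (y - y₀))) (fun t _ => ?_)
      ((hcont.clm_apply continuous_const).intervalIntegrable _ _)
    have h1 : HasDerivAt (fun t : ℝ => y₀ + t • (y - y₀)) (y - y₀) t := by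
      simpa using ((hasDerivAt_id t).smul_const (y - y₀)).const_add y₀
    exact ((ha.differentiable (by simp) _).hasFDerivAt).comp_hasDerivAt t h1
  have : h y (y - y₀) = a y - a y₀ := by
    rw [hint, ContinuousLinearMap.intervalIntegral_apply (hcont.intervalIntegrable _ _), key]
    simp
  rw [this]; ring

section Derivation

variable {E : Type*} [NormedAddCommGroup E] [NormedSpace ℝ E] [FiniteDimensional ℝ E]
  {M : Type*} [TopologicalSpace M] [ChartedSpace E M] [IsManifold 𝓘(ℝ, E) ∞ M] [T2Space M]

/-- A chart around a point, cut off to a globally defined smooth map. -/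
theorem exists_contMDiff_eventuallyEq_extChartAt (x : M) :
    ∃ f : M → E, ContMDiff 𝓘(ℝ, E) 𝓘(ℝ, E) ∞ f ∧ f =ᶠ[nhds x] extChartAt 𝓘(ℝ, E) x := by
  obtain ⟨ρ, -, -⟩ := (SmoothBumpFunction.nhds_basis_tsupport (I := 𝓘(ℝ, E)) x).mem_iff.1
    Filter.univ_mem
  refine ⟨fun m => ρ m • extChartAt 𝓘(ℝ, E) x m,
    ρ.contMDiff_smul (contMDiffOn_extChartAt (n := ∞)), ?_⟩
  filter_upwards [ρ.eventuallyEq_one] with m hm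
  simp [hm]

omit [T2Space M] in
/-- A smooth function on a manifold, transported to the model space by a chart and cut off. -/
theorem exists_contDiff_eventuallyEq_comp_symm (x : M) {a : M → ℝ}
    (ha : ContMDiff 𝓘(ℝ, E) 𝓘(ℝ, ℝ) ∞ a) :
    ∃ b : E → ℝ, ContDiff ℝ ∞ b ∧
      b =ᶠ[nhds (extChartAt 𝓘(ℝ, E) x x)] a ∘ (extChartAt 𝓘(ℝ, E) x).symm := by
  have htar : (extChartAt 𝓘(ℝ, E) x).target ∈ nhds (extChartAt 𝓘(ℝ, E) x x) :=
    extChartAt_target_mem_nhds x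
  obtain ⟨r, hr, hball⟩ := Metric.nhds_basis_closedBall.mem_iff.1 htar
  let β : ContDiffBump (extChartAt 𝓘(ℝ, E) x x) := ⟨r / 2, r, by positivity, by linarith⟩
  refine ⟨fun y => β y * a ((extChartAt 𝓘(ℝ, E) x).symm y), ?_, ?_⟩
  · rw [contDiff_iff_contDiffAt]
    intro y
    by_cases hy : y ∈ (extChartAt 𝓘(ℝ, E) x).target
    · have h1 : ContMDiffAt 𝓘(ℝ, E) 𝓘(ℝ, ℝ) ∞ (a ∘ (extChartAt 𝓘(ℝ, E) x).symm) y :=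
        (ha _).comp y ((contMDiffOn_extChartAt_symm (n := ∞) x).contMDiffAt
          ((isOpen_extChartAt_target x).mem_nhds hy))
      exact β.contDiff.contDiffAt.mul h1.contDiffAt
    · have hy' : y ∉ tsupport β := by
        rw [β.tsupport_eq]
        exact fun h => hy (hball h)
      have h0 : (fun y => β y * a ((extChartAt 𝓘(ℝ, E) x).symm y)) =ᶠ[nhds y] fun _ => 0 := by
        filter_upwards [notMem_tsupport_iff_eventuallyEq.1 hy'] with z hz
        simp only [hz, Pi.zero_apply, zero_mul]
      exact contDiffAt_const.congr_of_eventuallyEq h0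
  · filter_upwards [β.eventuallyEq_one] with y hy
    simp only [hy, Pi.one_apply, one_mul, Function.comp_apply]

/-- A point derivation of the algebra of smooth functions is local. -/
theorem pointDerivation_eq_zero_of_eventuallyEq {N : Type*} [AddCommGroup N] [Module ℝ N] (x : M)
    (κ : C^∞⟮𝓘(ℝ, E), M; 𝓘(ℝ, ℝ), ℝ⟯ →ₗ[ℝ] N)
    (hκ : ∀ a b, κ (a * b) = b x • κ a + a x • κ b)
    (a : C^∞⟮𝓘(ℝ, E), M; 𝓘(ℝ, ℝ), ℝ⟯) (ha : a =ᶠ[nhds x] 0) : κ a = 0 := by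
  obtain ⟨ρ, hρ, hsub⟩ := (SmoothBumpFunction.nhds_basis_tsupport (I := 𝓘(ℝ, E)) x).mem_iff.1 ha
  let r : C^∞⟮𝓘(ℝ, E), M; 𝓘(ℝ, ℝ), ℝ⟯ := ⟨ρ, ρ.contMDiff⟩
  -- The bump `r` is supported where `a` vanishes, so `0 = κ (r a) = a(x) κ r + r(x) κ a = κ a`.
  have h0 : r * a = 0 := by
    ext m
    by_cases hm : m ∈ tsupport ρ
    · have := hsub hm
      simp only [Set.mem_ofPred_eq] at this
      simp [this]
    · have : r m = 0 := image_eq_zero_of_notMem_tsupport hm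
      simp [this]
  have hr : r x = 1 := ρ.eq_one
  have := hκ r a
  rw [h0, map_zero, hr, ha.eq_of_nhds] at this
  simpa using this.symm

/-- A point derivation of the algebra of smooth functions kills the functions whose value and
derivative vanish at the point. -/
theorem pointDerivation_eq_zero {N : Type*} [AddCommGroup N] [Module ℝ N] (x : M)
    (κ : C^∞⟮𝓘(ℝ, E), M; 𝓘(ℝ, ℝ), ℝ⟯ →ₗ[ℝ] N)
    (hκ : ∀ a b, κ (a * b) = b x • κ a + a x • κ b)
    (a : C^∞⟮𝓘(ℝ, E), M; 𝓘(ℝ, ℝ), ℝ⟯) (ha : a x = 0)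
    (hda : HasMFDerivAt 𝓘(ℝ, E) 𝓘(ℝ, ℝ) a x (0 : E →L[ℝ] ℝ)) : κ a = 0 := by
  obtain ⟨Y, hY, hYx⟩ := exists_contMDiff_eventuallyEq_extChartAt (E := E) x
  obtain ⟨b, hb, hba⟩ := exists_contDiff_eventuallyEq_comp_symm x a.contMDiff
  set y₀ := extChartAt 𝓘(ℝ, E) x x with hy₀
  obtain ⟨h, hh, hh0, hexp⟩ := exists_contDiff_eq_add_apply_sub hb y₀
  have hYx0 : Y x = y₀ := hYx.eq_of_nhds
  have hb0 : b y₀ = 0 := by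
    rw [hba.eq_of_nhds, Function.comp_apply, hy₀, extChartAt_to_inv, ha]
  have hdb : fderiv ℝ b y₀ = 0 := by
    rw [hba.fderiv_eq]
    have := hda.2
    simp only [writtenInExtChartAt, extChartAt_model_space_eq_id, modelWithCornersSelf_coe,
      Set.range_id, PartialEquiv.refl_coe, Function.id_comp] at this
    have h2 : HasFDerivAt (a ∘ (extChartAt 𝓘(ℝ, E) x).symm) (0 : E →L[ℝ] ℝ) y₀ :=
      hasFDerivWithinAt_univ (F := ℝ).1 this
    exact h2.fderiv
  let v := Module.finBasis ℝ E
  -- Near `x`, `a = ∑ c i * d i`, where the `c i` are centred coordinates and the `d i` Hadamard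
  -- coefficients. Both factors vanish at `x`, the second because the derivative of `a` does, so the
  -- Leibniz rule kills every product.
  let c : Fin (Module.finrank ℝ E) → C^∞⟮𝓘(ℝ, E), M; 𝓘(ℝ, ℝ), ℝ⟯ := fun i =>
    ⟨fun m => (v.coord i).toContinuousLinearMap (Y m - y₀),
      (((v.coord i).toContinuousLinearMap.contDiff.comp
      (contDiff_id.sub contDiff_const)).contMDiff).comp hY⟩
  let d : Fin (Module.finrank ℝ E) → C^∞⟮𝓘(ℝ, E), M; 𝓘(ℝ, ℝ), ℝ⟯ := fun i =>
    ⟨fun m => h (Y m) (v i), ((hh.clm_apply contDiff_const).contMDiff).comp hY⟩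
  have hsum : κ (∑ i, c i * d i) = 0 := by
    rw [map_sum]
    refine Finset.sum_eq_zero fun i _ => ?_
    have h1 : c i x = 0 := by simp [c, hYx0]
    have h2 : d i x = 0 := by simp [d, hYx0, hh0, hdb]
    rw [hκ, h1, h2, zero_smul, zero_smul, add_zero]
  have hgerm : κ (a - ∑ i, c i * d i) = 0 := by
    refine pointDerivation_eq_zero_of_eventuallyEq x κ hκ _ ?_
    have hc : Filter.Tendsto (extChartAt 𝓘(ℝ, E) x) (nhds x) (nhds y₀) :=
      continuousAt_extChartAt x
    filter_upwards [hYx, hc.eventually hba, extChartAt_source_mem_nhds (I := 𝓘(ℝ, E)) x]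
      with m hm hm' hs
    have e1 : (∑ i, c i * d i : C^∞⟮𝓘(ℝ, E), M; 𝓘(ℝ, ℝ), ℝ⟯) m = h (Y m) (Y m - y₀) := by
      conv_rhs => rw [← v.sum_repr (Y m - y₀), map_sum]
      rw [← ContMDiffMap.coeFnAddMonoidHom_apply, map_sum, Finset.sum_apply]
      refine Finset.sum_congr rfl fun i _ => ?_
      rw [ContMDiffMap.coeFnAddMonoidHom_apply, ContMDiffMap.coe_mul, Pi.mul_apply, map_smul]
      rfl
    have e2 : a m = h (Y m) (Y m - y₀) := by
      have := hexp (Y m)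
      rw [hb0, zero_add] at this
      rw [← this, hm, hm', Function.comp_apply, PartialEquiv.left_inv _ hs]
    rw [ContMDiffMap.coe_sub, Pi.sub_apply, e1, e2, sub_self, Pi.zero_apply]
  rw [map_sub, hsum, sub_zero] at hgerm
  exact hgerm

end Derivation

/-! ### Iterated derivatives in a real variable, with a parameter -/

section Calculus

variable {Y E : Type*} [NormedAddCommGroup Y] [NormedSpace ℝ Y]
  [NormedAddCommGroup E] [NormedSpace ℝ E]

theorem iteratedDeriv_comp_mul_left (k : ℕ) (c : ℝ) (f : ℝ → E) :
    iteratedDeriv k (fun t => f (c * t)) = fun t => c ^ k • iteratedDeriv k f (c * t) := by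
  induction k with
  | zero => simp
  | succ k ih =>
    rw [iteratedDeriv_succ, ih]
    funext t
    rw [deriv_fun_const_smul_field, deriv_comp_mul_left, iteratedDeriv_succ, smul_smul, pow_succ]

theorem iteratedDeriv_clm_comp (k : ℕ) (T : Y →L[ℝ] E) {f : ℝ → Y} (hf : ContDiff ℝ ∞ f) :
    iteratedDeriv k (fun t => T (f t)) = fun t => T (iteratedDeriv k f t) := by
  induction k with
  | zero => simp
  | succ k ih =>
    rw [iteratedDeriv_succ, ih]
    funext t
    have hd : DifferentiableAt ℝ (iteratedDeriv k f) t :=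
      hf.differentiable_iteratedDeriv k (by exact_mod_cast ENat.natCast_lt_top k) t
    rw [iteratedDeriv_succ]
    exact (T.hasFDerivAt.comp_hasDerivAt t hd.hasDerivAt).deriv

theorem hasDerivAt_left {g : ℝ × Y → E} {p : ℝ × Y} (hg : DifferentiableAt ℝ g p) :
    HasDerivAt (fun t => g (t, p.2)) (fderiv ℝ g p (1, 0)) p.1 := by
  have h1 : HasDerivAt (fun t : ℝ => (t, p.2)) ((1 : ℝ), (0 : Y)) p.1 :=
    (hasDerivAt_id p.1).prodMk (hasDerivAt_const p.1 p.2)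
  exact hg.hasFDerivAt.comp_hasDerivAt p.1 h1

theorem hasFDerivAt_right {g : ℝ × Y → E} {p : ℝ × Y} (hg : DifferentiableAt ℝ g p) :
    HasFDerivAt (fun y => g (p.1, y)) ((fderiv ℝ g p).comp (ContinuousLinearMap.inr ℝ ℝ Y))
      p.2 :=
  hg.hasFDerivAt.comp p.2 (hasFDerivAt_prodMk_right p.1 p.2)

theorem eventually_differentiableAt {g : Y → E} {p : Y} (hg : ContDiffAt ℝ ∞ g p) :
    ∀ᶠ q in nhds p, DifferentiableAt ℝ g q := by
  have h1 : ContDiffAt ℝ 1 g p := hg.of_le (by norm_cast)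
  filter_upwards [h1.eventually (by simp)] with q hq
  exact hq.differentiableAt (by simp)

theorem contDiffAt_deriv_left {g : ℝ × Y → E} {p : ℝ × Y} (hg : ContDiffAt ℝ ∞ g p) :
    ContDiffAt ℝ ∞ (fun r : ℝ × Y => deriv (fun t => g (t, r.2)) r.1) p := by
  have h1 : ContDiffAt ℝ ∞ (fun r => fderiv ℝ g r ((1 : ℝ), (0 : Y))) p :=
    (hg.fderiv_right (m := ∞) le_rfl).clm_apply contDiffAt_const
  refine h1.congr_of_eventuallyEq ?_
  filter_upwards [eventually_differentiableAt hg] with r hr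
  exact (hasDerivAt_left hr).deriv

theorem contDiffAt_fderiv_right {g : ℝ × Y → E} {p : ℝ × Y} (hg : ContDiffAt ℝ ∞ g p) :
    ContDiffAt ℝ ∞ (fun r : ℝ × Y => fderiv ℝ (fun y => g (r.1, y)) r.2) p := by
  have h1 : ContDiffAt ℝ ∞ (fun r => (fderiv ℝ g r).comp (ContinuousLinearMap.inr ℝ ℝ Y)) p :=
    (hg.fderiv_right (m := ∞) le_rfl).clm_comp contDiffAt_const
  refine h1.congr_of_eventuallyEq ?_
  filter_upwards [eventually_differentiableAt hg] with r hr
  exact (hasFDerivAt_right hr).fderiv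

/-- Partial derivatives with respect to the two factors commute. -/
theorem fderiv_deriv_comm {g : ℝ × Y → E} {t : ℝ} {y : Y} (hg : ContDiffAt ℝ ∞ g (t, y)) :
    fderiv ℝ (fun y' => deriv (fun t' => g (t', y')) t) y =
      deriv (fun t' => fderiv ℝ (fun y' => g (t', y')) y) t := by
  have hd := eventually_differentiableAt hg
  have h2 : DifferentiableAt ℝ (fderiv ℝ g) (t, y) :=
    (hg.fderiv_right (m := ∞) le_rfl).differentiableAt (by simp)
  have hl : (fun y' => deriv (fun t' => g (t', y')) t) =ᶠ[nhds y]
      fun y' => fderiv ℝ g (t, y') (1, 0) := by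
    have hc : Filter.Tendsto (fun y' : Y => (t, y')) (nhds y) (nhds (t, y)) :=
      (by fun_prop : Continuous fun y' : Y => (t, y')).continuousAt
    filter_upwards [hc.eventually hd] with y' hy'
    exact (hasDerivAt_left hy').deriv
  have hr : (fun t' => fderiv ℝ (fun y' => g (t', y')) y) =ᶠ[nhds t]
      fun t' => (fderiv ℝ g (t', y)).comp (ContinuousLinearMap.inr ℝ ℝ Y) := by
    have hc : Filter.Tendsto (fun t' : ℝ => (t', y)) (nhds t) (nhds (t, y)) :=
      (by fun_prop : Continuous fun t' : ℝ => (t', y)).continuousAt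
    filter_upwards [hc.eventually hd] with t' ht'
    exact (hasFDerivAt_right ht').fderiv
  rw [hl.fderiv_eq, hr.deriv_eq]
  have e1 := (hasFDerivAt_right h2).clm_apply (hasFDerivAt_const ((1 : ℝ), (0 : Y)) y)
  have e2 := (hasDerivAt_left h2).clm_comp
    (hasDerivAt_const t (ContinuousLinearMap.inr ℝ ℝ Y))
  rw [e1.fderiv, e2.deriv]
  have hs := hg.isSymmSndFDerivAt (by simp only [minSmoothness_of_isRCLikeNormedField]; norm_cast)
  ext v
  simpa using hs (0, v) (1, 0)

theorem fderiv_iteratedDeriv_comm (k : ℕ) {T : Set Y} {g : ℝ × Y → E}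
    (hg : ∀ t, ∀ y ∈ T, ContDiffAt ℝ ∞ g (t, y)) (t : ℝ) {y : Y} (hy : y ∈ T) :
    fderiv ℝ (fun y' => iteratedDeriv k (fun t' => g (t', y')) t) y =
      iteratedDeriv k (fun t' => fderiv ℝ (fun y' => g (t', y')) y) t := by
  induction k generalizing g with
  | zero => simp
  | succ k ih =>
    simp only [iteratedDeriv_succ']
    rw [ih (g := fun r : ℝ × Y => deriv (fun t => g (t, r.2)) r.1)
      fun t y hy => contDiffAt_deriv_left (hg t y hy)]
    congr 1
    funext t'
    exact fderiv_deriv_comm (hg t' y hy)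

theorem differentiableAt_iteratedDeriv (k : ℕ) {T : Set Y} {g : ℝ × Y → E}
    (hg : ∀ t, ∀ y ∈ T, ContDiffAt ℝ ∞ g (t, y)) (t : ℝ) {y : Y} (hy : y ∈ T) :
    DifferentiableAt ℝ (fun y' => iteratedDeriv k (fun t' => g (t', y')) t) y := by
  induction k generalizing g with
  | zero =>
    simp only [iteratedDeriv_zero]
    exact (hasFDerivAt_right ((hg t y hy).differentiableAt (by simp))).differentiableAt
  | succ k ih =>
    simp only [iteratedDeriv_succ']
    exact ih (g := fun r : ℝ × Y => deriv (fun t => g (t, r.2)) r.1)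
      fun t y hy => contDiffAt_deriv_left (hg t y hy)

variable {F : Type*} [TopologicalSpace F] [ChartedSpace Y F] [IsManifold 𝓘(ℝ, Y) ∞ F]

theorem contMDiff_deriv_left {g : ℝ × F → E}
    (hg : ContMDiff (𝓘(ℝ, ℝ).prod 𝓘(ℝ, Y)) 𝓘(ℝ, E) ∞ g) :
    ContMDiff (𝓘(ℝ, ℝ).prod 𝓘(ℝ, Y)) 𝓘(ℝ, E) ∞
      (fun r : ℝ × F => deriv (fun t => g (t, r.2)) r.1) := by
  rintro ⟨t₀, q₀⟩
  let φ := extChartAt 𝓘(ℝ, Y) q₀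
  let G : ℝ × Y → E := fun p => g (p.1, φ.symm p.2)
  have hφ : ContMDiffAt 𝓘(ℝ, Y) 𝓘(ℝ, Y) ∞ φ q₀ := contMDiffAt_extChartAt
  have hφs : ContMDiffAt 𝓘(ℝ, Y) 𝓘(ℝ, Y) ∞ φ.symm (φ q₀) :=
    (contMDiffOn_extChartAt_symm (n := ∞) q₀).contMDiffAt (extChartAt_target_mem_nhds q₀)
  have hG : ContDiffAt ℝ ∞ G (t₀, φ q₀) :=
    contMDiffAt_iff_contDiffAt.1 ((hg _).comp (t₀, φ q₀) (contDiffAt_fst.contMDiffAt.prodMk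
      (ContMDiffAt.comp (t₀, φ q₀) hφs contDiffAt_snd.contMDiffAt)))
  have hd := (contDiffAt_deriv_left hG).contMDiffAt
  have hc : ContMDiffAt (𝓘(ℝ, ℝ).prod 𝓘(ℝ, Y)) 𝓘(ℝ, ℝ × Y) ∞
      (fun r : ℝ × F => (r.1, φ r.2)) (t₀, q₀) :=
    contMDiffAt_fst.prodMk_space (ContMDiffAt.comp (t₀, q₀) hφ contMDiffAt_snd)
  refine (ContMDiffAt.comp (t₀, q₀) (g := fun r : ℝ × Y => deriv (fun t => G (t, r.2)) r.1)
    hd hc).congr_of_eventuallyEq ?_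
  have hs : ∀ᶠ r : ℝ × F in nhds (t₀, q₀), r.2 ∈ φ.source :=
    continuousAt_snd.eventually (extChartAt_source_mem_nhds q₀)
  filter_upwards [hs] with r hr
  simp only [G, Function.comp_apply, φ.left_inv hr]

theorem contMDiff_iteratedDeriv_left (k : ℕ) {g : ℝ × F → E}
    (hg : ContMDiff (𝓘(ℝ, ℝ).prod 𝓘(ℝ, Y)) 𝓘(ℝ, E) ∞ g) :
    ContMDiff (𝓘(ℝ, ℝ).prod 𝓘(ℝ, Y)) 𝓘(ℝ, E) ∞
      (fun r : ℝ × F => iteratedDeriv k (fun t => g (t, r.2)) r.1) := by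
  induction k generalizing g with
  | zero => simpa using hg
  | succ k ih =>
    simp only [iteratedDeriv_succ']
    exact ih (contMDiff_deriv_left hg)

end Calculus

/-! ### Weight decomposition of a smooth representation of the monoid `(ℝ, ·)` -/

section MonoidRepresentation

variable {E : Type*} [NormedAddCommGroup E] [NormedSpace ℝ E] {L : ℝ → (E →L[ℝ] E)}

/-- The component of weight `k` of a smooth representation of the monoid `(ℝ, ·)`. -/
def weightComponent (L : ℝ → (E →L[ℝ] E)) (k : ℕ) : E →L[ℝ] E :=
  (k.factorial : ℝ)⁻¹ • iteratedDeriv k L 0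

/-- Differentiate `L (s t) = L s ∘ L t` `k` times in `t` at `t = 0`. -/
theorem comp_weightComponent (hL : ContDiff ℝ ∞ L) (hmul : ∀ s t, L (s * t) = (L s).comp (L t))
    (s : ℝ) (k : ℕ) : (L s).comp (weightComponent L k) = s ^ k • weightComponent L k := by
  have h1 := congrFun (iteratedDeriv_comp_mul_left k s L) 0
  have h2 := congrFun (iteratedDeriv_clm_comp k (ContinuousLinearMap.compL ℝ E E E (L s)) hL) 0
  simp only [hmul, mul_zero] at h1
  simp only [ContinuousLinearMap.compL_apply] at h2
  rw [weightComponent, ContinuousLinearMap.comp_smul, ← h2, h1, smul_comm]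

/-- Differentiate `L t ∘ P_k = t ^ k • P_k` `j` times at `t = 0`. The weight components are thus
mutually annihilating projections. -/
theorem weightComponent_comp (hL : ContDiff ℝ ∞ L) (hmul : ∀ s t, L (s * t) = (L s).comp (L t))
    (j k : ℕ) : (weightComponent L j).comp (weightComponent L k) =
      if j = k then weightComponent L k else 0 := by
  set P := weightComponent L k with hP
  have h1 := congrFun (iteratedDeriv_clm_comp j
    ((ContinuousLinearMap.compL ℝ E E E).flip P) hL) 0
  simp only [ContinuousLinearMap.flip_apply, ContinuousLinearMap.compL_apply, hP,
    comp_weightComponent hL hmul] at h1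
  have h2 := congrFun (iteratedDeriv_clm_comp j
    (ContinuousLinearMap.smulRight (1 : ℝ →L[ℝ] ℝ) P) (contDiff_id.pow k : ContDiff ℝ ∞ _)) 0
  simp only [ContinuousLinearMap.smulRight_apply, one_apply_eq_self, id] at h2
  rw [hP, weightComponent, ContinuousLinearMap.smul_comp, ← h1, h2, iteratedDeriv_fun_pow_zero]
  split_ifs with h
  · subst h
    rw [smul_smul, inv_mul_cancel₀ (by exact_mod_cast j.factorial_ne_zero), one_smul]
  · simp

/-- If the components of weights `0, …, n` kill `v`, Taylor's theorem bounds `‖L t v‖` by `C t ^ (n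
+ 1)` on `[0, 1]`. Since `v = (L 2)^m (L (2⁻¹ ^ m) v)`, this gives `‖v‖ ≤ C (‖L 2‖ / 2 ^ (n + 1)) ^
m` for all `m`, and `n` is chosen with `‖L 2‖ < 2 ^ n` so that the right side tends to 0. -/
theorem eq_zero_of_weightComponent (hL : ContDiff ℝ ∞ L)
    (hmul : ∀ s t, L (s * t) = (L s).comp (L t)) (hone : L 1 = ContinuousLinearMap.id ℝ E) :
    ∃ K : ℕ, ∀ v, (∀ k < K, weightComponent L k v = 0) → v = 0 := by
  obtain ⟨n, hn⟩ := pow_unbounded_of_one_lt ‖L 2‖ (one_lt_two (α := ℝ))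
  refine ⟨n + 1, fun v hv => ?_⟩
  have hLv : ContDiff ℝ ∞ fun t => L t v := hL.clm_apply contDiff_const
  obtain ⟨C, hC⟩ := exists_taylor_mean_remainder_bound (f := fun t => L t v) (n := n)
    (zero_le_one (α := ℝ)) ((hLv.of_le (by exact_mod_cast le_top)).contDiffOn)
  have hzero : ∀ x, taylorWithinEval (fun t => L t v) n (Set.Icc 0 1) 0 x = 0 := by
    intro x
    rw [taylor_within_apply]
    refine Finset.sum_eq_zero fun k hk => ?_
    rw [iteratedDerivWithin_eq_iteratedDeriv (uniqueDiffOn_Icc_zero_one)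
      ((hLv.of_le (by exact_mod_cast le_top)).contDiffAt) (by simp)]
    have h1 := congrFun (iteratedDeriv_clm_comp k (ContinuousLinearMap.apply ℝ E v) hL) 0
    simp only [ContinuousLinearMap.apply_apply] at h1
    have h2 := hv k (by simpa using hk)
    rw [weightComponent, smul_apply, smul_eq_zero] at h2
    rw [h1, h2.resolve_left (inv_ne_zero (by exact_mod_cast k.factorial_ne_zero)), smul_zero]
  have hpow : ∀ m : ℕ, ‖v‖ ≤ ‖L 2‖ ^ m * ‖L ((2 : ℝ)⁻¹ ^ m) v‖ := by
    intro m
    induction m with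
    | zero => simp [hone]
    | succ m ih =>
      have e : L ((2 : ℝ)⁻¹ ^ m) v = L 2 (L ((2 : ℝ)⁻¹ ^ (m + 1)) v) := by
        rw [← ContinuousLinearMap.comp_apply, ← hmul]
        congr 2
        rw [pow_succ]; ring
      calc ‖v‖ ≤ ‖L 2‖ ^ m * ‖L 2 (L ((2 : ℝ)⁻¹ ^ (m + 1)) v)‖ := by rw [← e]; exact ih
        _ ≤ ‖L 2‖ ^ m * (‖L 2‖ * ‖L ((2 : ℝ)⁻¹ ^ (m + 1)) v‖) := by
            gcongr; exact ContinuousLinearMap.le_opNorm _ _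
        _ = _ := by ring
  have hbound : ∀ m : ℕ, ‖v‖ ≤ C * (‖L 2‖ * (2 : ℝ)⁻¹ ^ (n + 1)) ^ m := by
    intro m
    have h2m : (2 : ℝ)⁻¹ ^ m ∈ Set.Icc (0 : ℝ) 1 :=
      ⟨by positivity, pow_le_one₀ (by norm_num) (by norm_num)⟩
    have := hC _ h2m
    rw [hzero, sub_zero, sub_zero] at this
    calc ‖v‖ ≤ ‖L 2‖ ^ m * ‖L ((2 : ℝ)⁻¹ ^ m) v‖ := hpow m
      _ ≤ ‖L 2‖ ^ m * (C * ((2 : ℝ)⁻¹ ^ m) ^ (n + 1)) := by gcongr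
      _ = _ := by rw [mul_pow, pow_right_comm]; ring
  have hlt : ‖L 2‖ * (2 : ℝ)⁻¹ ^ (n + 1) < 1 := by
    rw [inv_pow, ← div_eq_mul_inv, div_lt_one (by positivity), pow_succ]
    have : (0 : ℝ) < 2 ^ n := by positivity
    linarith
  have hlim : Filter.Tendsto (fun m : ℕ => C * (‖L 2‖ * (2 : ℝ)⁻¹ ^ (n + 1)) ^ m) Filter.atTop
      (nhds (C * 0)) :=
    (tendsto_pow_atTop_nhds_zero_of_lt_one (by positivity) hlt).const_mul C
  have := ge_of_tendsto' hlim hbound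
  rw [mul_zero] at this
  exact norm_le_zero_iff.1 this

end MonoidRepresentation

/-! ### Derivatives on manifolds as maps between model spaces -/

section HasDer

variable {Y Y' Y'' : Type*} [NormedAddCommGroup Y] [NormedSpace ℝ Y]
  [NormedAddCommGroup Y'] [NormedSpace ℝ Y'] [NormedAddCommGroup Y''] [NormedSpace ℝ Y'']
  {X X' X'' : Type*} [TopologicalSpace X] [ChartedSpace Y X]
  [TopologicalSpace X'] [ChartedSpace Y' X'] [TopologicalSpace X''] [ChartedSpace Y'' X'']

/-- `HasMFDerivAt` for boundaryless models, with the tangent spaces replaced by the model spaces. -/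
def HasDer (f : X → X') (p : X) (T : Y →L[ℝ] Y') : Prop :=
  HasMFDerivAt 𝓘(ℝ, Y) 𝓘(ℝ, Y') f p T

theorem HasDer.unique {f : X → X'} {p : X} {T T' : Y →L[ℝ] Y'} (h : HasDer f p T)
    (h' : HasDer f p T') : T = T' :=
  hasMFDerivAt_unique h h'

theorem HasDer.comp {f : X → X'} {g : X' → X''} {p : X} {T : Y →L[ℝ] Y'} {S : Y' →L[ℝ] Y''}
    (hg : HasDer g (f p) S) (hf : HasDer f p T) : HasDer (fun x => g (f x)) p (S.comp T) :=
  HasMFDerivAt.comp p hg hf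

theorem HasDer.congr {f g : X → X'} {p : X} {T : Y →L[ℝ] Y'} (h : HasDer f p T)
    (hfg : g =ᶠ[nhds p] f) : HasDer g p T :=
  HasMFDerivAt.congr_of_eventuallyEq h hfg

/-- The derivative at a point, as a map between the model spaces. -/
def der (f : X → X') (p : X) : Y →L[ℝ] Y' :=
  mfderiv 𝓘(ℝ, Y) 𝓘(ℝ, Y') f p

theorem hasDer_der {f : X → X'} {p : X} (h : ContMDiffAt 𝓘(ℝ, Y) 𝓘(ℝ, Y') ∞ f p) :
    HasDer f p (der f p : Y →L[ℝ] Y') :=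
  (h.mdifferentiableAt (by simp)).hasMFDerivAt

theorem hasDer_id (p : X) : HasDer (fun x : X => x) p (ContinuousLinearMap.id ℝ Y) :=
  hasMFDerivAt_id p

theorem hasDer_const (c : X') (p : X) : HasDer (fun _ : X => c) p (0 : Y →L[ℝ] Y') :=
  hasMFDerivAt_const c p

theorem hasDer_iff_hasFDerivAt {f : Y → Y'} {p : Y} {T : Y →L[ℝ] Y'} :
    HasDer f p T ↔ HasFDerivAt f T p :=
  hasMFDerivAt_iff_hasFDerivAt

theorem hasDer_clm_comp (S : Y' →L[ℝ] Y'') {f : X → Y'} {p : X}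
    {T : Y →L[ℝ] Y'} (hf : HasDer f p T) : HasDer (fun x => S (f x)) p (S.comp T) :=
  HasDer.comp (g := S) (hasDer_iff_hasFDerivAt.2 S.hasFDerivAt) hf

theorem HasDer.add {f g : X → Y'} {p : X} {T S : Y →L[ℝ] Y'} (hf : HasDer f p T)
    (hg : HasDer g p S) : HasDer (fun x => f x + g x) p (T + S) :=
  HasMFDerivAt.add hf hg

theorem HasDer.sum {ι : Type*} {t : Finset ι} {f : ι → X → Y'} {p : X} {T : ι → Y →L[ℝ] Y'}
    (hf : ∀ i ∈ t, HasDer (f i) p (T i)) : HasDer (fun x => ∑ i ∈ t, f i x) p (∑ i ∈ t, T i) := by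
  classical
  induction t using Finset.induction_on with
  | empty => simpa using hasDer_const (0 : Y') p
  | insert a t ha ih =>
    simp only [Finset.sum_insert ha]
    exact (hf a (Finset.mem_insert_self a t)).add
      (ih fun i hi => hf i (Finset.mem_insert_of_mem hi))

theorem HasDer.mul {f g : X → ℝ} {p : X} {T S : Y →L[ℝ] ℝ} (hf : HasDer f p T)
    (hg : HasDer g p S) : HasDer (fun x => f x * g x) p (f p • S + g p • T) :=
  HasMFDerivAt.mul hf hg

theorem HasDer.mul_const {f : X → ℝ} {p : X} {T : Y →L[ℝ] ℝ} (hf : HasDer f p T) (c : ℝ) :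
    HasDer (fun x => f x * c) p (c • T) := by
  simpa using hf.mul (hasDer_const c p)

theorem hasDer_of_hasFDerivAt {f : X → Y'} {p : X} {T : Y →L[ℝ] Y'} (hc : ContinuousAt f p)
    (h : HasFDerivAt (f ∘ (extChartAt 𝓘(ℝ, Y) p).symm) T (extChartAt 𝓘(ℝ, Y) p p)) :
    HasDer f p T := by
  refine ⟨hc, ?_⟩
  simp only [writtenInExtChartAt, extChartAt_model_space_eq_id, modelWithCornersSelf_coe,
    Set.range_id, PartialEquiv.refl_coe, Function.id_comp]
  exact h.hasFDerivWithinAt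

end HasDer

/-! ### Equivariant linearization of the homogeneity structure -/

namespace GradedBundle

variable {EM : Type*} [NormedAddCommGroup EM] [NormedSpace ℝ EM]
  {M : Type*} [TopologicalSpace M] [ChartedSpace EM M]
  {EF : Type*} [NormedAddCommGroup EF] [NormedSpace ℝ EF]
  {F : Type*} [TopologicalSpace F] [ChartedSpace EF F]

theorem act_incl (B : GradedBundle EM M EF F) (t : ℝ) (x : M) :
    B.act t (B.incl x) = B.incl x := by
  have h : B.incl x = B.act 0 (B.incl x) := by rw [← B.incl_proj, B.proj_incl]
  rw [h, ← B.act_mul, mul_zero]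

variable [FiniteDimensional ℝ EF] [IsManifold 𝓘(ℝ, EF) ∞ F] [T2Space F]

/-- Near the zero section, a homogeneity structure is linearized by a globally defined smooth
equivariant map to a representation of the monoid `(ℝ, ·)`. -/
theorem exists_linearization (B : GradedBundle EM M EF F) (x₀ : M) :
    ∃ (Φ : F → EF) (L : ℝ → (EF →L[ℝ] EF)), ContMDiff 𝓘(ℝ, EF) 𝓘(ℝ, EF) ∞ Φ ∧
      (∀ t q, Φ (B.act t q) = L t (Φ q)) ∧
      ∃ T : EF →L[ℝ] EF, HasDer Φ (B.incl x₀) T ∧ ∀ v, T v = 0 → v = 0 := by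
  set p₀ := B.incl x₀ with hp₀
  have hfix : ∀ t, B.act t p₀ = p₀ := fun t => B.act_incl t x₀
  obtain ⟨f, hf, hfφ⟩ := exists_contMDiff_eventuallyEq_extChartAt (E := EF) p₀
  set φ := extChartAt 𝓘(ℝ, EF) p₀ with hφ
  set y₀ := φ p₀ with hy₀
  have hy₀T : y₀ ∈ φ.target := mem_extChartAt_target p₀
  have hsymm₀ : φ.symm y₀ = p₀ := extChartAt_to_inv p₀
  have hf₀ : f p₀ = y₀ := hfφ.eq_of_nhds
  -- The source is read in the chart and the target through the cut-off chart `f`, so that `g` makes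
  -- sense for every `t`, even when `h_t` leaves the chart domain.
  let g : ℝ × EF → EF := fun r => f (B.act r.1 (φ.symm r.2))
  have hfact : ContMDiff (𝓘(ℝ, ℝ).prod 𝓘(ℝ, EF)) 𝓘(ℝ, EF) ∞
      (fun r : ℝ × F => f (B.act r.1 r.2)) := hf.comp B.contMDiff_act
  have hg : ∀ t, ∀ y ∈ φ.target, ContDiffAt ℝ ∞ g (t, y) := by
    intro t y hy
    have hφs : ContMDiffAt 𝓘(ℝ, EF) 𝓘(ℝ, EF) ∞ φ.symm y :=
      (contMDiffOn_extChartAt_symm (n := ∞) p₀).contMDiffAt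
        ((isOpen_extChartAt_target p₀).mem_nhds hy)
    exact contMDiffAt_iff_contDiffAt.1 ((hfact _).comp (t, y)
      (contDiffAt_fst.contMDiffAt.prodMk
        (ContMDiffAt.comp (t, y) hφs contDiffAt_snd.contMDiffAt)))
  -- The derivative of `h_t` at its fixed point `p₀`; the chain rule makes it multiplicative in `t`.
  let L : ℝ → (EF →L[ℝ] EF) := fun t => fderiv ℝ (fun y => g (t, y)) y₀
  have hL : ContDiff ℝ ∞ L := by
    rw [contDiff_iff_contDiffAt]
    intro t
    exact (contDiffAt_fderiv_right (hg t y₀ hy₀T)).comp t (contDiffAt_id.prodMk contDiffAt_const)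
  have hsymm : Filter.Tendsto φ.symm (nhds y₀) (nhds p₀) := by
    have := continuousAt_extChartAt_symm (I := 𝓘(ℝ, EF)) p₀
    rwa [ContinuousAt, extChartAt_to_inv] at this
  have hactsymm : ∀ t, Filter.Tendsto (fun y => B.act t (φ.symm y)) (nhds y₀) (nhds p₀) := by
    intro t
    have h1 := ((B.contMDiff_act_apply t).continuous.tendsto p₀)
    rw [hfix] at h1
    exact h1.comp hsymm
  have hone : L 1 = ContinuousLinearMap.id ℝ EF := by
    have : (fun y => g (1, y)) =ᶠ[nhds y₀] id := by
      filter_upwards [hsymm.eventually hfφ, extChartAt_target_mem_nhds p₀] with y hy hy'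
      simp only [g, B.act_one, hy, id]
      exact φ.right_inv hy'
    simp only [L]
    rw [this.fderiv_eq, fderiv_id]
  have hmul : ∀ s t, L (s * t) = (L s).comp (L t) := by
    intro s t
    have h1 : (fun y => g (s * t, y)) =ᶠ[nhds y₀] (fun y => g (s, y)) ∘ (fun y => g (t, y)) := by
      filter_upwards [(hactsymm t).eventually hfφ,
        (hactsymm t).eventually (extChartAt_source_mem_nhds (I := 𝓘(ℝ, EF)) p₀)] with y hy hy'
      simp only [g, Function.comp_apply, hy, B.act_mul]
      rw [φ.left_inv hy']
    have h2 : g (t, y₀) = y₀ := by simp only [g, hsymm₀, hfix, hf₀]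
    simp only [L]
    rw [h1.fderiv_eq]
    have d1 := (hasFDerivAt_right ((hg t y₀ hy₀T).differentiableAt (by simp))).differentiableAt
    have d2 := (hasFDerivAt_right ((hg s y₀ hy₀T).differentiableAt (by simp))).differentiableAt
    rw [fderiv_comp _ (by rw [h2]; exact d2) d1, h2]
  obtain ⟨K, hK⟩ := eq_zero_of_weightComponent hL hmul hone
  let P := weightComponent L
  -- The `k`-th Taylor coefficient at `t = 0` of the orbit map. It is global on `F`, and homogeneous
  -- of weight `k` because `h_t h_s = h_{ts}`.
  let c : ℕ → F → EF := fun k q =>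
    (k.factorial : ℝ)⁻¹ • iteratedDeriv k (fun t => f (B.act t q)) 0
  have hc : ∀ k, ContMDiff 𝓘(ℝ, EF) 𝓘(ℝ, EF) ∞ (c k) := by
    intro k
    have h1 := (contMDiff_iteratedDeriv_left k hfact).comp
      (contMDiff_const.prodMk contMDiff_id : ContMDiff 𝓘(ℝ, EF) (𝓘(ℝ, ℝ).prod 𝓘(ℝ, EF)) ∞
        fun q : F => ((0 : ℝ), q))
    exact ((contDiff_const_smul (k.factorial : ℝ)⁻¹).contMDiff).comp h1
  have hcact : ∀ k s q, c k (B.act s q) = s ^ k • c k q := by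
    intro k s q
    have h1 := congrFun (iteratedDeriv_comp_mul_left k s (fun t => f (B.act t q))) 0
    simp only [mul_zero] at h1
    simp only [c, ← B.act_mul, mul_comm _ s]
    rw [h1, smul_comm]
  -- Composing with `P k` matches weights: `L t ∘ P k = t ^ k • P k` turns homogeneity of the `c k`
  -- into equivariance of `Φ`.
  let Φ : F → EF := fun q => ∑ k ∈ Finset.range K, P k (c k q)
  have hΦ : ContMDiff 𝓘(ℝ, EF) 𝓘(ℝ, EF) ∞ Φ :=
    contMDiff_finsetSum fun k _ => (P k).contDiff.contMDiff.comp (hc k)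
  refine ⟨Φ, L, hΦ, ?_, ?_⟩
  · intro t q
    simp only [Φ, map_sum, hcact, map_smul]
    refine Finset.sum_congr rfl fun k _ => ?_
    have := congrArg (fun T => T (c k q)) (comp_weightComponent hL hmul t k)
    exact this.symm
  -- Exchanging the derivatives in `y` and `t` shows that `c k` has derivative `P k` at `y₀`. Hence
  -- `Φ` has derivative `∑ P k ∘ P k = ∑ P k`; applying each `P j` to a kernel vector isolates its
  -- components, so the choice of `K` makes it zero.
  · have hd : HasFDerivAt (Φ ∘ φ.symm) (∑ k ∈ Finset.range K, (P k).comp (P k)) y₀ := by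
      refine HasFDerivAt.fun_sum fun k _ => ?_
      refine (P k).hasFDerivAt.comp y₀ ?_
      have h1 := (differentiableAt_iteratedDeriv k hg 0 hy₀T).hasFDerivAt
      rw [fderiv_iteratedDeriv_comm k hg 0 hy₀T] at h1
      exact h1.const_smul _
    refine ⟨_, hasDer_of_hasFDerivAt hΦ.continuous.continuousAt hd, fun v hv => ?_⟩
    have hsum : ∑ k ∈ Finset.range K, P k v = 0 := by
      rw [← hv, sum_apply]
      refine Finset.sum_congr rfl fun k _ => ?_
      simp only [P, weightComponent_comp hL hmul, if_true]
    refine hK v fun j hj => ?_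
    have h1 := congrArg (P j) hsum
    have h2 : ∀ k, P j (P k v) = if j = k then P k v else 0 := by
      intro k
      have := congrArg (fun T => T v) (weightComponent_comp hL hmul j k)
      simp only [ContinuousLinearMap.comp_apply] at this
      rw [this]
      split_ifs <;> rfl
    rw [map_sum, map_zero] at h1
    simpa [h2, hj] using h1

end GradedBundle

/-! ### Invertibility and smooth dependence of derivatives, tested in a fixed chart -/

section Charts

variable {Y E : Type*} [NormedAddCommGroup Y] [NormedSpace ℝ Y]
  [NormedAddCommGroup E] [NormedSpace ℝ E]
  {X : Type*} [TopologicalSpace X] [ChartedSpace Y X] [IsManifold 𝓘(ℝ, Y) ∞ X]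

theorem hasDer_extChartAt (q₀ : X) {q : X} (hq : q ∈ (extChartAt 𝓘(ℝ, Y) q₀).source) :
    HasDer (extChartAt 𝓘(ℝ, Y) q₀) q (der (extChartAt 𝓘(ℝ, Y) q₀) q : Y →L[ℝ] Y) :=
  hasDer_der (contMDiffAt_extChartAt' (by rwa [extChartAt_source] at hq))

theorem contMDiffAt_extChartAt_symm (q₀ : X) {q : X} (hq : q ∈ (extChartAt 𝓘(ℝ, Y) q₀).source) :
    ContMDiffAt 𝓘(ℝ, Y) 𝓘(ℝ, Y) ∞ (extChartAt 𝓘(ℝ, Y) q₀).symm (extChartAt 𝓘(ℝ, Y) q₀ q) :=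
  (contMDiffOn_extChartAt_symm (n := ∞) q₀).contMDiffAt
    ((isOpen_extChartAt_target q₀).mem_nhds ((extChartAt 𝓘(ℝ, Y) q₀).map_source hq))

theorem isInvertible_der_extChartAt (q₀ : X) {q : X}
    (hq : q ∈ (extChartAt 𝓘(ℝ, Y) q₀).source) :
    ∃ C : Y ≃L[ℝ] Y, (C : Y →L[ℝ] Y) = der (extChartAt 𝓘(ℝ, Y) q₀) q := by
  set φ := extChartAt 𝓘(ℝ, Y) q₀ with hφ
  have hsymm : φ.symm (φ q) = q := φ.left_inv hq
  have h1 : HasDer φ q (der φ q : Y →L[ℝ] Y) := hasDer_extChartAt q₀ hq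
  have h2 : HasDer φ.symm (φ q) (der φ.symm (φ q) : Y →L[ℝ] Y) :=
    hasDer_der (contMDiffAt_extChartAt_symm q₀ hq)
  have e1 : (der φ.symm (φ q) : Y →L[ℝ] Y).comp (der φ q) = ContinuousLinearMap.id ℝ Y := by
    refine (h2.comp h1).unique ((hasDer_id q).congr ?_)
    filter_upwards [(isOpen_extChartAt_source (I := 𝓘(ℝ, Y)) q₀).mem_nhds hq] with r hr
    exact φ.left_inv hr
  have e2 : (der φ q : Y →L[ℝ] Y).comp (der φ.symm (φ q)) = ContinuousLinearMap.id ℝ Y := by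
    have h1' : HasDer φ (φ.symm (φ q)) (der φ q : Y →L[ℝ] Y) := by rw [hsymm]; exact h1
    refine (h1'.comp h2).unique ((hasDer_id (φ q)).congr ?_)
    filter_upwards [(isOpen_extChartAt_target (I := 𝓘(ℝ, Y)) q₀).mem_nhds (φ.map_source hq)]
      with r hr
    exact φ.right_inv hr
  exact ⟨ContinuousLinearEquiv.equivOfInverse (der φ q) (der φ.symm (φ q))
    (fun v => congrArg (fun T => T v) e1) (fun v => congrArg (fun T => T v) e2), rfl⟩

/-- The derivative of a function, expressed through its representative in a fixed chart. -/
theorem der_eq_fderiv_comp (q₀ : X) {q : X} (hq : q ∈ (extChartAt 𝓘(ℝ, Y) q₀).source)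
    {f : X → E} (hf : ContMDiffAt 𝓘(ℝ, Y) 𝓘(ℝ, E) ∞ f q) :
    (der f q : Y →L[ℝ] E) = (fderiv ℝ (f ∘ (extChartAt 𝓘(ℝ, Y) q₀).symm)
        (extChartAt 𝓘(ℝ, Y) q₀ q)).comp (der (extChartAt 𝓘(ℝ, Y) q₀) q) := by
  set φ := extChartAt 𝓘(ℝ, Y) q₀ with hφ
  have hsymm : φ.symm (φ q) = q := φ.left_inv hq
  have h3 : HasDer (f ∘ φ.symm) (φ q) (fderiv ℝ (f ∘ φ.symm) (φ q)) := by
    rw [hasDer_iff_hasFDerivAt]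
    have : ContMDiffAt 𝓘(ℝ, Y) 𝓘(ℝ, E) ∞ (f ∘ φ.symm) (φ q) :=
      ContMDiffAt.comp (φ q) (by rw [hsymm]; exact hf) (contMDiffAt_extChartAt_symm q₀ hq)
    exact (this.contDiffAt.differentiableAt (by simp)).hasFDerivAt
  refine (hasDer_der hf).unique ((h3.comp (hasDer_extChartAt q₀ hq)).congr ?_)
  filter_upwards [(isOpen_extChartAt_source (I := 𝓘(ℝ, Y)) q₀).mem_nhds hq] with r hr
  rw [hφ, Function.comp_apply, PartialEquiv.left_inv _ hr]

theorem isInvertible_comp_equiv_iff (T : Y →L[ℝ] E) (C : Y ≃L[ℝ] Y) :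
    (T.comp (C : Y →L[ℝ] Y)).IsInvertible ↔ T.IsInvertible := by
  constructor
  · rintro ⟨e, he⟩
    refine ⟨C.symm.trans e, ?_⟩
    ext v
    have := congrArg (fun S => S (C.symm v)) he
    simpa using this
  · rintro ⟨e, rfl⟩
    exact ⟨C.trans e, rfl⟩

theorem isInvertible_of_injective [FiniteDimensional ℝ Y] (T : Y →L[ℝ] Y)
    (hT : ∀ v, T v = 0 → v = 0) : T.IsInvertible := by
  have hinj : Function.Injective (T : Y →ₗ[ℝ] Y) := (injective_iff_map_eq_zero _).2 hT
  exact ⟨(LinearEquiv.ofInjectiveEndo (T : Y →ₗ[ℝ] Y) hinj).toContinuousLinearEquiv, rfl⟩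

theorem isInvertible_der_iff (q₀ : X) {q : X} (hq : q ∈ (extChartAt 𝓘(ℝ, Y) q₀).source)
    {f : X → E} (hf : ContMDiffAt 𝓘(ℝ, Y) 𝓘(ℝ, E) ∞ f q) :
    (der f q : Y →L[ℝ] E).IsInvertible ↔ (fderiv ℝ (f ∘ (extChartAt 𝓘(ℝ, Y) q₀).symm)
        (extChartAt 𝓘(ℝ, Y) q₀ q)).IsInvertible := by
  obtain ⟨C, hC⟩ := isInvertible_der_extChartAt q₀ hq
  rw [der_eq_fderiv_comp q₀ hq hf, ← hC, isInvertible_comp_equiv_iff]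

theorem contDiffAt_fderiv_comp_symm {f : X → E} {q₀ : X}
    (hf : ContMDiffAt 𝓘(ℝ, Y) 𝓘(ℝ, E) ∞ f q₀) :
    ContDiffAt ℝ ∞ (fderiv ℝ (f ∘ (extChartAt 𝓘(ℝ, Y) q₀).symm)) (extChartAt 𝓘(ℝ, Y) q₀ q₀) := by
  have : ContMDiffAt 𝓘(ℝ, Y) 𝓘(ℝ, E) ∞ (f ∘ (extChartAt 𝓘(ℝ, Y) q₀).symm)
      (extChartAt 𝓘(ℝ, Y) q₀ q₀) :=
    ContMDiffAt.comp _ (by rw [extChartAt_to_inv]; exact hf)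
      (contMDiffAt_extChartAt_symm q₀ (mem_extChartAt_source q₀))
  exact this.contDiffAt.fderiv_right (m := ∞) le_rfl

/-- `der Φ q` is computed in the preferred chart at `q`, so it need not be continuous in `q`. Its
invertibility is the same in the fixed chart at `q₀`, where the derivative is continuous and
invertible operators form an open set. -/
theorem isOpen_isInvertible_der [CompleteSpace Y] {Φ : X → E}
    (hΦ : ContMDiff 𝓘(ℝ, Y) 𝓘(ℝ, E) ∞ Φ) :
    IsOpen {q | (der Φ q : Y →L[ℝ] E).IsInvertible} := by
  rw [isOpen_iff_mem_nhds]
  intro q₀ h₀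
  rw [Set.mem_ofPred_eq, isInvertible_der_iff q₀ (mem_extChartAt_source q₀) (hΦ q₀)] at h₀
  obtain ⟨e, he⟩ := h₀
  have hnh := ContinuousLinearEquiv.nhds e
  rw [he] at hnh
  have hcont := (contDiffAt_fderiv_comp_symm (hΦ q₀)).continuousAt
  filter_upwards [(continuousAt_extChartAt (I := 𝓘(ℝ, Y)) q₀).eventually
    (hcont.eventually hnh), extChartAt_source_mem_nhds (I := 𝓘(ℝ, Y)) q₀] with q hq hs
  rw [isInvertible_der_iff q₀ hs (hΦ q)]
  exact hq

/-- The derivative of a function in the direction of a coordinate vector field of the local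
coordinates `Φ` is smooth. -/
theorem contMDiffAt_der_comp_inverse [CompleteSpace Y] {E' : Type*} [NormedAddCommGroup E']
    [NormedSpace ℝ E'] {Φ : X → E} (hΦ : ContMDiff 𝓘(ℝ, Y) 𝓘(ℝ, E) ∞ Φ) {c : X → E'} {q₀ : X}
    (hc : ∀ᶠ q in nhds q₀, ContMDiffAt 𝓘(ℝ, Y) 𝓘(ℝ, E') ∞ c q)
    (h₀ : (der Φ q₀ : Y →L[ℝ] E).IsInvertible) :
    ContMDiffAt 𝓘(ℝ, Y) 𝓘(ℝ, E →L[ℝ] E') ∞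
      (fun q => (der c q : Y →L[ℝ] E').comp (der Φ q : Y →L[ℝ] E).inverse) q₀ := by
  have h₀' := h₀
  rw [isInvertible_der_iff q₀ (mem_extChartAt_source q₀) (hΦ q₀)] at h₀'
  obtain ⟨e, he⟩ := h₀'
  have hinv : ContDiffAt ℝ ∞ (fun y => (fderiv ℝ (Φ ∘ (extChartAt 𝓘(ℝ, Y) q₀).symm) y).inverse)
      (extChartAt 𝓘(ℝ, Y) q₀ q₀) := by
    have h1 : ContDiffAt ℝ ∞ ContinuousLinearMap.inverse
        (fderiv ℝ (Φ ∘ (extChartAt 𝓘(ℝ, Y) q₀).symm) (extChartAt 𝓘(ℝ, Y) q₀ q₀)) := by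
      rw [← he]; exact contDiffAt_map_inverse e
    exact h1.comp _ (contDiffAt_fderiv_comp_symm (hΦ q₀))
  have hcomp := ((contDiffAt_fderiv_comp_symm hc.self_of_nhds).clm_comp hinv).contMDiffAt
  refine (ContMDiffAt.comp q₀ hcomp (contMDiffAt_extChartAt (n := ∞))).congr_of_eventuallyEq ?_
  filter_upwards [hc, extChartAt_source_mem_nhds (I := 𝓘(ℝ, Y)) q₀,
    (isOpen_isInvertible_der hΦ).mem_nhds h₀] with q hq hs hi
  rw [isInvertible_der_iff q₀ hs (hΦ q)] at hi
  obtain ⟨C, hC⟩ := isInvertible_der_extChartAt q₀ hs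
  obtain ⟨e', he'⟩ := hi
  -- Both derivatives acquire the same factor `C`, the derivative of the fixed chart, which cancels
  -- in the composite with the inverse.
  rw [der_eq_fderiv_comp q₀ hs (hΦ q), der_eq_fderiv_comp q₀ hs hq, Function.comp_apply,
    ← hC, ← he']
  have : ((e' : Y →L[ℝ] E).comp (C : Y →L[ℝ] Y)) = ((C.trans e' : Y ≃L[ℝ] E) : Y →L[ℝ] E) := rfl
  rw [this, ContinuousLinearMap.inverse_equiv, ContinuousLinearMap.inverse_equiv]
  ext v
  simp

end Charts

/-! ### The equivariant horizontal lift -/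

namespace GradedBundle

variable {EM : Type*} [NormedAddCommGroup EM] [NormedSpace ℝ EM]
  {M : Type*} [TopologicalSpace M] [ChartedSpace EM M]
  {EF : Type*} [NormedAddCommGroup EF] [NormedSpace ℝ EF]
  {F : Type*} [TopologicalSpace F] [ChartedSpace EF F]

/-- As `t → 0`, `h_t q` tends to the zero section, so by openness `dΦ` is invertible at `h_t q` for
some `t ≠ 0`. Equivariance gives `dΦ ∘ dh_t = L t ∘ dΦ` at `q`; the left side is injective, hence so
is `dΦ` at `q`. -/
theorem isInvertible_der_of_incl [FiniteDimensional ℝ EF] [IsManifold 𝓘(ℝ, EF) ∞ F]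
    (B : GradedBundle EM M EF F) {Φ : F → EF} {L : ℝ → (EF →L[ℝ] EF)}
    (hΦ : ContMDiff 𝓘(ℝ, EF) 𝓘(ℝ, EF) ∞ Φ) (hL : ∀ t q, Φ (B.act t q) = L t (Φ q)) {q : F}
    (hq : (der Φ (B.incl (B.proj q)) : EF →L[ℝ] EF).IsInvertible) :
    (der Φ q : EF →L[ℝ] EF).IsInvertible := by
  have hcont : Continuous fun t => B.act t q :=
    B.contMDiff_act.continuous.comp (by fun_prop : Continuous fun t : ℝ => (t, q))
  have hopen : IsOpen {t : ℝ | (der Φ (B.act t q) : EF →L[ℝ] EF).IsInvertible} :=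
    (isOpen_isInvertible_der hΦ).preimage hcont
  have h0 : {t : ℝ | (der Φ (B.act t q) : EF →L[ℝ] EF).IsInvertible} ∈ nhds (0 : ℝ) := by
    refine hopen.mem_nhds ?_
    rw [Set.mem_ofPred_eq, ← B.incl_proj]
    exact hq
  obtain ⟨t, ht, ht0⟩ : ∃ t : ℝ, (der Φ (B.act t q) : EF →L[ℝ] EF).IsInvertible ∧ t ≠ 0 := by
    obtain ⟨ε, hε, hball⟩ := Metric.mem_nhds_iff.1 h0
    have h2 : ε / 2 ∈ Metric.ball (0 : ℝ) ε := by
      rw [Metric.mem_ball, dist_zero_right, Real.norm_eq_abs, abs_of_pos (by positivity)]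
      linarith
    exact ⟨ε / 2, hball h2, by positivity⟩
  refine isInvertible_of_injective _ fun v hv => ?_
  have hΦ' : ∀ p, HasDer Φ p (der Φ p : EF →L[ℝ] EF) := fun p => hasDer_der (hΦ p)
  have hact : ∀ s p, HasDer (B.act s) p (der (B.act s) p : EF →L[ℝ] EF) :=
    fun s p => hasDer_der (B.contMDiff_act_apply s p)
  have e1 : (der Φ (B.act t q) : EF →L[ℝ] EF).comp (der (B.act t) q) =
      (L t).comp (der Φ q : EF →L[ℝ] EF) := by
    refine (HasDer.comp (hΦ' _) (hact t q)).unique ?_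
    simp only [hL]
    exact hasDer_clm_comp (L t) (hΦ' q)
  have e2 : (der (B.act t⁻¹) (B.act t q) : EF →L[ℝ] EF).comp (der (B.act t) q) =
      ContinuousLinearMap.id ℝ EF := by
    refine ((hact _ _).comp (hact t q)).unique ?_
    simp only [← B.act_mul, inv_mul_cancel₀ ht0, B.act_one]
    exact hasDer_id q
  have h1 : (der Φ (B.act t q) : EF →L[ℝ] EF) ((der (B.act t) q : EF →L[ℝ] EF) v) = 0 := by
    have := congrArg (fun T => T v) e1
    simp only [ContinuousLinearMap.comp_apply, hv, map_zero] at this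
    exact this
  obtain ⟨e, he⟩ := ht
  rw [← he] at h1
  have h2 : (der (B.act t) q : EF →L[ℝ] EF) v = 0 := by simpa using h1
  have := congrArg (fun T => T v) e2
  simp only [ContinuousLinearMap.comp_apply, h2, map_zero] at this
  exact this.symm

/-- The horizontal lift of tangent vectors of the base, determined by a linearization `Φ`. -/
def horizontalLift (B : GradedBundle EM M EF F) (Φ : F → EF) (q : F) : EM →L[ℝ] EF :=
  (der Φ q : EF →L[ℝ] EF).inverse.comp (der (fun x => Φ (B.incl x)) (B.proj q) : EM →L[ℝ] EF)

variable (B : GradedBundle EM M EF F) {Φ : F → EF} {L : ℝ → (EF →L[ℝ] EF)}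
  (hΦ : ContMDiff 𝓘(ℝ, EF) 𝓘(ℝ, EF) ∞ Φ) (hL : ∀ t q, Φ (B.act t q) = L t (Φ q))

include hΦ hL

/-- The action fixes the zero section, so `Φ ∘ incl` takes values in the vectors fixed by `L t`, and
so does its derivative. -/
theorem comp_der_incl (t : ℝ) (x : M) :
    (L t).comp (der (fun x => Φ (B.incl x)) x : EM →L[ℝ] EF) = der (fun x => Φ (B.incl x)) x := by
  have hz : HasDer (fun x => Φ (B.incl x)) x (der (fun x => Φ (B.incl x)) x : EM →L[ℝ] EF) :=
    hasDer_der ((hΦ.comp B.contMDiff_incl) x)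
  refine (hasDer_clm_comp (L t) hz).unique ?_
  simp only [← hL, B.act_incl]
  exact hz

/-- Let `Z` be the derivative of `Φ ∘ incl`. Since `Φ ∘ incl ∘ proj = L 0 ∘ Φ`, one gets `Z ∘ dτ ∘ H
= L 0 ∘ dΦ ∘ H = L 0 ∘ Z = Z`. And `Z` is injective, because `incl` has a left inverse and `dΦ` is
invertible on the zero section. -/
theorem der_proj_comp_horizontalLift {q : F}
    (hq : (der Φ q : EF →L[ℝ] EF).IsInvertible)
    (hq' : (der Φ (B.incl (B.proj q)) : EF →L[ℝ] EF).IsInvertible) :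
    (der B.proj q : EF →L[ℝ] EM).comp (B.horizontalLift Φ q) = ContinuousLinearMap.id ℝ EM := by
  set x := B.proj q with hx
  set Z : EM →L[ℝ] EF := der (fun x => Φ (B.incl x)) x with hZ
  have hz : HasDer (fun x => Φ (B.incl x)) x Z := hasDer_der ((hΦ.comp B.contMDiff_incl) x)
  have hΦ' : ∀ p, HasDer Φ p (der Φ p : EF →L[ℝ] EF) := fun p => hasDer_der (hΦ p)
  have hτ : ∀ p, HasDer B.proj p (der B.proj p : EF →L[ℝ] EM) :=
    fun p => hasDer_der (B.contMDiff_proj p)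
  have e1 : Z.comp (der B.proj q) = (L 0).comp (der Φ q : EF →L[ℝ] EF) := by
    refine (HasDer.comp (g := fun x => Φ (B.incl x)) hz (hτ q)).unique ?_
    simp only [B.incl_proj, hL]
    exact hasDer_clm_comp (L 0) (hΦ' q)
  have hι : HasDer B.incl x (der B.incl x : EM →L[ℝ] EF) := hasDer_der (B.contMDiff_incl x)
  have e2 : Z = (der Φ (B.incl x) : EF →L[ℝ] EF).comp (der B.incl x) :=
    hz.unique (HasDer.comp (hΦ' _) hι)
  have e3 : (der B.proj (B.incl x) : EF →L[ℝ] EM).comp (der B.incl x) =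
      ContinuousLinearMap.id ℝ EM := by
    refine ((hτ _).comp hι).unique ?_
    simp only [B.proj_incl]
    exact hasDer_id x
  have hinj : ∀ v w, Z v = Z w → v = w := by
    intro v w hvw
    rw [e2] at hvw
    simp only [ContinuousLinearMap.comp_apply] at hvw
    have h1 : (der B.incl x : EM →L[ℝ] EF) v = (der B.incl x : EM →L[ℝ] EF) w := by
      rw [← hq'.inverse_apply_self ((der B.incl x : EM →L[ℝ] EF) v), hvw,
        hq'.inverse_apply_self]
    have hv := congrArg (fun T => T v) e3
    have hw := congrArg (fun T => T w) e3
    simp only [ContinuousLinearMap.comp_apply, h1] at hv hw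
    exact hv.symm.trans hw
  ext v
  apply hinj
  have h1 := congrArg (fun T => T (B.horizontalLift Φ q v)) e1
  have h2 : (der Φ q : EF →L[ℝ] EF) (B.horizontalLift Φ q v) = Z v := by
    simp only [horizontalLift, ContinuousLinearMap.comp_apply, hq.self_apply_inverse]
    rfl
  have h3 := congrArg (fun T => T v) (B.comp_der_incl hΦ hL 0 x)
  simp only [ContinuousLinearMap.comp_apply, h2] at h1 h3
  exact h1.trans h3

/-- After applying `dΦ` at `h_t q`, both sides become the derivative of `Φ ∘ incl`, which `L t`
fixes. -/
theorem der_act_comp_horizontalLift (t : ℝ) {q : F}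
    (hq : (der Φ q : EF →L[ℝ] EF).IsInvertible)
    (hq' : (der Φ (B.act t q) : EF →L[ℝ] EF).IsInvertible) :
    (der (B.act t) q : EF →L[ℝ] EF).comp (B.horizontalLift Φ q) =
      B.horizontalLift Φ (B.act t q) := by
  have hΦ' : ∀ p, HasDer Φ p (der Φ p : EF →L[ℝ] EF) := fun p => hasDer_der (hΦ p)
  have e1 : (der Φ (B.act t q) : EF →L[ℝ] EF).comp (der (B.act t) q) =
      (L t).comp (der Φ q : EF →L[ℝ] EF) := by
    refine (HasDer.comp (hΦ' _) (hasDer_der (B.contMDiff_act_apply t q))).unique ?_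
    simp only [hL]
    exact hasDer_clm_comp (L t) (hΦ' q)
  ext v
  have h1 := congrArg (fun T => T (B.horizontalLift Φ q v)) e1
  have h3 := congrArg (fun T => T v) (B.comp_der_incl hΦ hL t (B.proj q))
  simp only [ContinuousLinearMap.comp_apply] at h1 h3
  have h2 : (der Φ q : EF →L[ℝ] EF) (B.horizontalLift Φ q v) =
      (der (fun x => Φ (B.incl x)) (B.proj q) : EM →L[ℝ] EF) v := by
    simp only [horizontalLift, ContinuousLinearMap.comp_apply, hq.self_apply_inverse]
  rw [h2, h3] at h1
  simp only [ContinuousLinearMap.comp_apply]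
  rw [← hq'.inverse_apply_self ((der (B.act t) q : EF →L[ℝ] EF) (B.horizontalLift Φ q v)), h1]
  simp only [horizontalLift, ContinuousLinearMap.comp_apply, B.proj_act]

end GradedBundle

/-! ### Componentwise smooth maps into vector spaces and algebras -/

section ComponentsSmooth

variable (Y : Type*) [NormedAddCommGroup Y] [NormedSpace ℝ Y]
  {X : Type*} [TopologicalSpace X] [ChartedSpace Y X]
  {W : Type*} [AddCommGroup W] [Module ℝ W]

/-- A map to a vector space is smooth at a point, in the sense that all its components are. -/
def ComponentsSmoothAt (u : X → W) (p : X) : Prop :=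
  ∀ ℓ : Module.Dual ℝ W, ContMDiffAt 𝓘(ℝ, Y) 𝓘(ℝ, ℝ) ∞ (fun q => ℓ (u q)) p

variable {Y} {u v : X → W} {p : X}

theorem ComponentsSmoothAt.congr (hu : ComponentsSmoothAt Y u p) (h : v =ᶠ[nhds p] u) :
    ComponentsSmoothAt Y v p := fun ℓ =>
  (hu ℓ).congr_of_eventuallyEq (h.mono fun q hq => by simp only [hq])

theorem componentsSmoothAt_const (w : W) : ComponentsSmoothAt Y (fun _ : X => w) p :=
  fun _ => contMDiffAt_const

theorem ComponentsSmoothAt.add (hu : ComponentsSmoothAt Y u p) (hv : ComponentsSmoothAt Y v p) :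
    ComponentsSmoothAt Y (fun q => u q + v q) p := fun ℓ => by
  simp only [map_add]
  exact (hu ℓ).add (hv ℓ)

theorem ComponentsSmoothAt.smul {a : X → ℝ} (ha : ContMDiffAt 𝓘(ℝ, Y) 𝓘(ℝ, ℝ) ∞ a p)
    (hu : ComponentsSmoothAt Y u p) : ComponentsSmoothAt Y (fun q => a q • u q) p := fun ℓ => by
  simp only [map_smul, smul_eq_mul]
  exact ha.mul (hu ℓ)

theorem ComponentsSmoothAt.sum {ι : Type*} {t : Finset ι} {u : ι → X → W}
    (hu : ∀ i ∈ t, ComponentsSmoothAt Y (u i) p) :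
    ComponentsSmoothAt Y (fun q => ∑ i ∈ t, u i q) p := fun ℓ => by
  simpa only [map_sum] using ContMDiffAt.sum fun i hi => hu i hi ℓ

theorem ComponentsSmoothAt.mul {R : Type*} [Ring R] [Algebra ℝ R] [FiniteDimensional ℝ R]
    {u v : X → R} (hu : ComponentsSmoothAt Y u p) (hv : ComponentsSmoothAt Y v p) :
    ComponentsSmoothAt Y (fun q => u q * v q) p := by
  let b := Module.finBasis ℝ R
  have h : (fun q => u q * v q) = fun q =>
      ∑ i, ∑ j, (b.coord i (u q) * b.coord j (v q)) • (b i * b j) := by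
    funext q
    conv_lhs => rw [← b.sum_repr (u q), ← b.sum_repr (v q)]
    simp only [Finset.sum_mul_sum, smul_mul_smul_comm, Module.Basis.coord_apply]
  rw [h]
  exact .sum fun i _ => .sum fun j _ =>
    .smul ((hu (b.coord i)).mul (hv (b.coord j))) (componentsSmoothAt_const _)

/-- Needed for changes of trivialization. For a constant argument, induct over the exterior algebra;
a varying argument is then expanded in a basis. -/
theorem ComponentsSmoothAt.map_dualMap {V : Type*} [NormedAddCommGroup V] [NormedSpace ℝ V]
    [FiniteDimensional ℝ V] {g : X → (V →L[ℝ] V)}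
    (hg : ContMDiffAt 𝓘(ℝ, Y) 𝓘(ℝ, V →L[ℝ] V) ∞ g p)
    {u : X → ExteriorAlgebra ℝ (Module.Dual ℝ V)} (hu : ComponentsSmoothAt Y u p) :
    ComponentsSmoothAt Y
      (fun q => ExteriorAlgebra.map (g q : V →ₗ[ℝ] V).dualMap (u q)) p := by
  have hconst : ∀ w : ExteriorAlgebra ℝ (Module.Dual ℝ V), ComponentsSmoothAt Y
      (fun q => ExteriorAlgebra.map (g q : V →ₗ[ℝ] V).dualMap w) p := by
    intro w
    induction w using ExteriorAlgebra.induction with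
    | algebraMap r =>
      simp only [AlgHom.commutes]
      exact componentsSmoothAt_const _
    | ι φ =>
      intro ℓ
      -- On a generator the expression is linear in the operator, hence smooth in it.
      let T : (V →L[ℝ] V) →ₗ[ℝ] ℝ :=
        { toFun := fun S => ℓ (ExteriorAlgebra.ι ℝ ((S : V →ₗ[ℝ] V).dualMap φ))
          map_add' := fun S S' => by
            rw [← map_add, ← map_add]
            congr 2
            ext v
            simp
          map_smul' := fun c S => by
            rw [RingHom.id_apply, ← map_smul, ← map_smul]
            congr 2
            ext v
            simp }
      have := (T.toContinuousLinearMap.contDiff (n := ∞)).contMDiff.contMDiffAt.comp p hg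
      refine this.congr_of_eventuallyEq (Filter.Eventually.of_forall fun q => ?_)
      simp only [ExteriorAlgebra.map_apply_ι]
      rfl
    | mul a b ha hb =>
      simp only [map_mul]
      exact ha.mul hb
    | add a b ha hb =>
      simp only [map_add]
      exact ha.add hb
  let b := Module.finBasis ℝ (ExteriorAlgebra ℝ (Module.Dual ℝ V))
  have h : (fun q => ExteriorAlgebra.map (g q : V →ₗ[ℝ] V).dualMap (u q)) = fun q =>
      ∑ i, b.coord i (u q) • ExteriorAlgebra.map (g q : V →ₗ[ℝ] V).dualMap (b i) := by
    funext q
    conv_lhs => rw [← b.sum_repr (u q)]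
    simp only [map_sum, map_smul, Module.Basis.coord_apply]
  rw [h]
  exact .sum fun i _ => .smul (hu (b.coord i)) (hconst (b i))

end ComponentsSmooth

/-! ### Expressions of functions in one fixed trivialization of `A` -/

section FixedRep

variable {EM : Type*} [NormedAddCommGroup EM] [NormedSpace ℝ EM]
  {M : Type*} [TopologicalSpace M] [ChartedSpace EM M]
  {EF : Type*} [NormedAddCommGroup EF] [NormedSpace ℝ EF]
  {F : Type*} [TopologicalSpace F] [ChartedSpace EF F]
  {V : Type*} [NormedAddCommGroup V] [NormedSpace ℝ V]
  {A : M → Type*} [∀ x, AddCommGroup (A x)] [∀ x, Module ℝ (A x)]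
  [∀ x, TopologicalSpace (A x)] [TopologicalSpace (Bundle.TotalSpace V A)]
  [FiberBundle V A] [VectorBundle ℝ V A] {τ : F → M}

variable (V) in
/-- The expression of `f` in the preferred local trivialization of `A` at `x₀`. -/
def fixedRep (x₀ : M) (f : PreFunction A τ) (q : F) : ExteriorAlgebra ℝ (Module.Dual ℝ V) :=
  ExteriorAlgebra.map ((trivializationAt V A x₀).symmₗ ℝ (τ q)).dualMap (f (τ q) ⟨q, rfl⟩)

variable (V) in
/-- The element of `Λ (A x)*` with prescribed expression in the local trivialization at `x₀`. -/
def ofRep (A : M → Type*) [∀ x, AddCommGroup (A x)] [∀ x, Module ℝ (A x)]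
    [∀ x, TopologicalSpace (A x)] [TopologicalSpace (Bundle.TotalSpace V A)]
    [FiberBundle V A] [VectorBundle ℝ V A] (x₀ x : M) :
    ExteriorAlgebra ℝ (Module.Dual ℝ V) →ₐ[ℝ] ExteriorAlgebra ℝ (Module.Dual ℝ (A x)) :=
  ExteriorAlgebra.map ((trivializationAt V A x₀).linearMapAt ℝ x).dualMap

theorem map_symm_ofRep {x₀ x : M} (hx : x ∈ (trivializationAt V A x₀).baseSet)
    (w : ExteriorAlgebra ℝ (Module.Dual ℝ V)) :
    ExteriorAlgebra.map ((trivializationAt V A x₀).symmₗ ℝ x).dualMap (ofRep V A x₀ x w) = w := by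
  rw [ofRep, ← AlgHom.comp_apply, ExteriorAlgebra.map_comp_map]
  convert AlgHom.id_apply (R := ℝ) w
  convert ExteriorAlgebra.map_id (R := ℝ) (M := Module.Dual ℝ V)
  ext φ v
  simp only [LinearMap.comp_apply, LinearMap.dualMap_apply, LinearMap.id_apply,
    Bundle.Trivialization.linearMapAt_symmₗ _ hx]

theorem ofRep_map_symm {x₀ x : M} (hx : x ∈ (trivializationAt V A x₀).baseSet)
    (w : ExteriorAlgebra ℝ (Module.Dual ℝ (A x))) :
    ofRep V A x₀ x (ExteriorAlgebra.map ((trivializationAt V A x₀).symmₗ ℝ x).dualMap w) = w := by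
  rw [ofRep, ← AlgHom.comp_apply, ExteriorAlgebra.map_comp_map]
  convert AlgHom.id_apply (R := ℝ) w
  convert ExteriorAlgebra.map_id (R := ℝ) (M := Module.Dual ℝ (A x))
  ext φ v
  simp only [LinearMap.comp_apply, LinearMap.dualMap_apply, LinearMap.id_apply,
    Bundle.Trivialization.symmₗ_linearMapAt _ hx]

omit [TopologicalSpace F] in
theorem ofRep_fixedRep (x₀ : M) (f : PreFunction A τ) {q : F}
    (hq : τ q ∈ (trivializationAt V A x₀).baseSet) :
    ofRep V A x₀ (τ q) (fixedRep V x₀ f q) = f (τ q) ⟨q, rfl⟩ :=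
  ofRep_map_symm hq _

omit [TopologicalSpace F] in
theorem fixedRep_eq (x₀ : M) (f : PreFunction A τ) (q : F) {x : M} (h : τ q = x) :
    fixedRep V x₀ f q =
      ExteriorAlgebra.map ((trivializationAt V A x₀).symmₗ ℝ x).dualMap (f x ⟨q, h⟩) := by
  subst h
  rfl

omit [TopologicalSpace F] in
theorem fixedRep_change (x₀ x₁ : M) (f : PreFunction A τ) {q : F}
    (h₀ : τ q ∈ (trivializationAt V A x₀).baseSet)
    (h₁ : τ q ∈ (trivializationAt V A x₁).baseSet) :
    fixedRep V x₁ f q = ExteriorAlgebra.map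
      (((trivializationAt V A x₁).coordChangeL ℝ (trivializationAt V A x₀) (τ q) :
        V →L[ℝ] V) : V →ₗ[ℝ] V).dualMap (fixedRep V x₀ f q) := by
  rw [fixedRep, ← ofRep_fixedRep (V := V) x₀ f h₀, ofRep, ← AlgHom.comp_apply,
    ExteriorAlgebra.map_comp_map]
  congr 2
  ext φ v
  simp only [LinearMap.comp_apply, LinearMap.dualMap_apply]
  congr 1
  rw [ContinuousLinearMap.coe_coe, ContinuousLinearEquiv.coe_coe,
    Bundle.Trivialization.coordChangeL_apply _ _ ⟨h₁, h₀⟩,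
    Bundle.Trivialization.coe_linearMapAt_of_mem _ h₀]
  dsimp only
  rw [Bundle.Trivialization.symmₗ_apply _ h₁]

variable [FiniteDimensional ℝ V] [ContMDiffVectorBundle ∞ V A 𝓘(ℝ, EM)]

/-- Two expressions differ by the smooth coordinate change of `A`. Smoothness, defined with a
trivialization varying with the point, can therefore be tested in any single one. -/
theorem componentsSmoothAt_fixedRep_change {x₀ x₁ : M} {f : PreFunction A τ} {q : F}
    (hτ : ContMDiffAt 𝓘(ℝ, EF) 𝓘(ℝ, EM) ∞ τ q)
    (h₀ : τ q ∈ (trivializationAt V A x₀).baseSet)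
    (h₁ : τ q ∈ (trivializationAt V A x₁).baseSet)
    (hf : ComponentsSmoothAt EF (fixedRep V x₀ f) q) :
    ComponentsSmoothAt EF (fixedRep V x₁ f) q := by
  have hg : ContMDiffAt 𝓘(ℝ, EF) 𝓘(ℝ, V →L[ℝ] V) ∞ (fun p =>
      ((trivializationAt V A x₁).coordChangeL ℝ (trivializationAt V A x₀) (τ p) :
        V →L[ℝ] V)) q := hτ.coordChangeL h₁ h₀
  refine (ComponentsSmoothAt.map_dualMap hg hf).congr ?_
  filter_upwards [hτ.continuousAt.eventually ((trivializationAt V A x₀).open_baseSet.mem_nhds h₀),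
    hτ.continuousAt.eventually ((trivializationAt V A x₁).open_baseSet.mem_nhds h₁)] with p hp₀ hp₁
  exact fixedRep_change x₀ x₁ f hp₀ hp₁

theorem isSmooth_of_fixedRep {f : PreFunction A τ} (hτ : ContMDiff 𝓘(ℝ, EF) 𝓘(ℝ, EM) ∞ τ)
    (hf : ∀ q, ∃ x₀, τ q ∈ (trivializationAt V A x₀).baseSet ∧
      ComponentsSmoothAt EF (fixedRep V x₀ f) q) : IsSmooth EF V f := by
  intro q
  obtain ⟨x₀, h₀, h⟩ := hf q
  exact componentsSmoothAt_fixedRep_change (hτ q) h₀ (FiberBundle.mem_baseSet_trivializationAt' _) h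

theorem IsSmooth.componentsSmoothAt_fixedRep {f : PreFunction A τ} (hf : IsSmooth EF V f)
    (hτ : ContMDiff 𝓘(ℝ, EF) 𝓘(ℝ, EM) ∞ τ) {x₀ : M} {q : F}
    (h₀ : τ q ∈ (trivializationAt V A x₀).baseSet) :
    ComponentsSmoothAt EF (fixedRep V x₀ f) q :=
  componentsSmoothAt_fixedRep_change (x₀ := τ q) (hτ q)
    (FiberBundle.mem_baseSet_trivializationAt' _) h₀ (hf q)

end FixedRep

section FixedRepAlgebra

variable {M F : Type*} [TopologicalSpace M]
  {V : Type*} [NormedAddCommGroup V] [NormedSpace ℝ V]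
  {A : M → Type*} [∀ x, AddCommGroup (A x)] [∀ x, Module ℝ (A x)]
  [∀ x, TopologicalSpace (A x)] [TopologicalSpace (Bundle.TotalSpace V A)]
  [FiberBundle V A] [VectorBundle ℝ V A] {τ : F → M} (x₀ : M) (f g : PreFunction A τ) (q : F)

theorem fixedRep_add : fixedRep V x₀ (f + g) q = fixedRep V x₀ f q + fixedRep V x₀ g q := by
  simp [fixedRep]

theorem fixedRep_mul : fixedRep V x₀ (f * g) q = fixedRep V x₀ f q * fixedRep V x₀ g q := by
  simp [fixedRep]

theorem fixedRep_smul (c : ℝ) : fixedRep V x₀ (c • f) q = c • fixedRep V x₀ f q := by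
  simp [fixedRep]

theorem fixedRep_scale (t : ℝ) :
    fixedRep V x₀ (τ := τ) (fun x q => ExteriorAlgebra.map (t • LinearMap.id) (f x q)) q =
      ExteriorAlgebra.map (t • LinearMap.id) (fixedRep V x₀ f q) := by
  simp only [fixedRep, ← AlgHom.comp_apply, ExteriorAlgebra.map_comp_map]
  congr 2

end FixedRepAlgebra

/-! ### Odd vector fields on `ΠA` are first order operators -/

section Base

variable {EM : Type*} [NormedAddCommGroup EM] [NormedSpace ℝ EM]
  {M : Type*} [TopologicalSpace M] [ChartedSpace EM M]
  {V : Type*} [NormedAddCommGroup V] [NormedSpace ℝ V] [FiniteDimensional ℝ V]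
  {A : M → Type*} [∀ x, AddCommGroup (A x)] [∀ x, Module ℝ (A x)]
  [∀ x, TopologicalSpace (A x)] [TopologicalSpace (Bundle.TotalSpace V A)]
  [FiberBundle V A] [VectorBundle ℝ V A]

/-- The value of a function on `ΠA` at a point of the base. -/
def evalAt (x : M) : Functions A EM V (id : M → M) →ₐ[ℝ]
    ExteriorAlgebra ℝ (Module.Dual ℝ (A x)) where
  toFun s := s.1 x ⟨x, rfl⟩
  map_one' := rfl
  map_mul' _ _ := rfl
  map_zero' := rfl
  map_add' _ _ := rfl
  commutes' _ := rfl

/-- Functions on the base, as functions on `ΠA`. -/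
def scalar : C^∞⟮𝓘(ℝ, EM), M; 𝓘(ℝ, ℝ), ℝ⟯ →ₐ[ℝ] Functions A EM V (id : M → M) where
  toFun a := ⟨fun x _ => algebraMap ℝ _ (a x), fun q₀ ℓ => by
    have h : (fun q => ℓ (localRep V (A := A) (τ := (id : M → M))
        (fun x _ => algebraMap ℝ _ (a x)) q₀ q)) = fun q => a q * ℓ 1 := by
      funext q
      simp only [localRep, id, Algebra.algebraMap_eq_smul_one, map_smul, map_one, smul_eq_mul]
    rw [h]
    exact (a.contMDiff q₀).mul contMDiffAt_const⟩
  map_one' := by ext x q; simp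
  map_mul' a b := by ext x q; simp
  map_zero' := by ext x q; simp
  map_add' a b := by ext x q; simp
  commutes' r := by
    ext x q
    rfl

@[simp]
theorem evalAt_scalar (x : M) (a : C^∞⟮𝓘(ℝ, EM), M; 𝓘(ℝ, ℝ), ℝ⟯) :
    evalAt x (scalar a : Functions A EM V (id : M → M)) = algebraMap ℝ _ (a x) := rfl

theorem fibreScale_scalar (t : ℝ) (a : C^∞⟮𝓘(ℝ, EM), M; 𝓘(ℝ, ℝ), ℝ⟯) :
    fibreScale t (scalar a : Functions A EM V (id : M → M)) = scalar a := by
  ext x q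
  simp [fibreScale, scalar]

theorem fixedRep_scalar (x₀ x : M) (a : C^∞⟮𝓘(ℝ, EM), M; 𝓘(ℝ, ℝ), ℝ⟯) :
    fixedRep V x₀ (scalar a : Functions A EM V (id : M → M)).1 x = algebraMap ℝ _ (a x) := by
  simp [fixedRep, scalar]

variable (D : OddVectorField A EM V (id : M → M))

theorem evalAt_leibniz (x : M) (s r : Functions A EM V (id : M → M)) :
    evalAt x (D (s * r)) =
      evalAt x (D s) * evalAt x r + evalAt x (parity s) * evalAt x (D r) := by
  rw [D.leibniz, map_add, map_mul, map_mul]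

/-- The restriction of an odd vector field on `ΠA` to functions on the base, at a point. -/
def scalarDer (x : M) :
    C^∞⟮𝓘(ℝ, EM), M; 𝓘(ℝ, ℝ), ℝ⟯ →ₗ[ℝ] ExteriorAlgebra ℝ (Module.Dual ℝ (A x)) :=
  (evalAt x).toLinearMap ∘ₗ D.toLinearMap ∘ₗ scalar.toLinearMap

theorem evalAt_scalar_mul (x : M) (a : C^∞⟮𝓘(ℝ, EM), M; 𝓘(ℝ, ℝ), ℝ⟯)
    (s : Functions A EM V (id : M → M)) :
    evalAt x (D (scalar a * s)) = scalarDer D x a * evalAt x s + a x • evalAt x (D s) := by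
  rw [evalAt_leibniz, parity, fibreScale_scalar, evalAt_scalar, Algebra.smul_def]
  rfl

theorem scalarDer_mul (x : M) (a b : C^∞⟮𝓘(ℝ, EM), M; 𝓘(ℝ, ℝ), ℝ⟯) :
    scalarDer D x (a * b) = b x • scalarDer D x a + a x • scalarDer D x b := by
  have := evalAt_scalar_mul D x a (scalar b)
  rw [← map_mul, evalAt_scalar, ← Algebra.commutes, ← Algebra.smul_def] at this
  exact this

theorem scalarDer_one (x : M) : scalarDer D x 1 = 0 := by
  have := scalarDer_mul D x 1 1
  rw [mul_one, ContMDiffMap.coe_one, Pi.one_apply, one_smul] at this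
  simpa using this

variable [ContMDiffVectorBundle ∞ V A 𝓘(ℝ, EM)]

/-- The sections of `Λ A*` which are constant multiples of a cut-off function `χ` in the local
trivialization at `x₀`. -/
def frame (A : M → Type*) [∀ x, AddCommGroup (A x)] [∀ x, Module ℝ (A x)]
    [∀ x, TopologicalSpace (A x)] [TopologicalSpace (Bundle.TotalSpace V A)]
    [FiberBundle V A] [VectorBundle ℝ V A] [ContMDiffVectorBundle ∞ V A 𝓘(ℝ, EM)]
    (x₀ : M) (χ : C^∞⟮𝓘(ℝ, EM), M; 𝓘(ℝ, ℝ), ℝ⟯)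
    (hχ : tsupport χ ⊆ (trivializationAt V A x₀).baseSet) :
    ExteriorAlgebra ℝ (Module.Dual ℝ V) →ₗ[ℝ] Functions A EM V (id : M → M) where
  toFun w := ⟨fun x _ => χ x • ofRep V A x₀ x w, by
    refine isSmooth_of_fixedRep contMDiff_id fun x => ?_
    by_cases hx : x ∈ (trivializationAt V A x₀).baseSet
    · refine ⟨x₀, hx, ?_⟩
      refine ((componentsSmoothAt_const w).smul (χ.contMDiff x)).congr ?_
      filter_upwards [(trivializationAt V A x₀).open_baseSet.mem_nhds hx] with y hy
      rw [fixedRep, map_smul]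
      exact congrArg _ (map_symm_ofRep hy w)
    · refine ⟨x, FiberBundle.mem_baseSet_trivializationAt' _, ?_⟩
      refine (componentsSmoothAt_const 0).congr ?_
      filter_upwards [notMem_tsupport_iff_eventuallyEq.1 fun h => hx (hχ h)] with y hy
      simp [fixedRep, hy]⟩
  map_add' w w' := by
    ext x q
    simp only [map_add, smul_add]
    rfl
  map_smul' c w := by
    ext x q
    simp only [map_smul, RingHom.id_apply, smul_comm _ c]
    rfl

variable {x₀ : M} {χ : C^∞⟮𝓘(ℝ, EM), M; 𝓘(ℝ, ℝ), ℝ⟯}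
  (hχ : tsupport χ ⊆ (trivializationAt V A x₀).baseSet)

theorem evalAt_frame (x : M) (w : ExteriorAlgebra ℝ (Module.Dual ℝ V)) :
    evalAt x (frame A x₀ χ hχ w) = χ x • ofRep V A x₀ x w := rfl

theorem fixedRep_frame {x : M} (hx : x ∈ (trivializationAt V A x₀).baseSet)
    (w : ExteriorAlgebra ℝ (Module.Dual ℝ V)) :
    fixedRep V x₀ (frame A x₀ χ hχ w).1 x = χ x • w := by
  change ExteriorAlgebra.map _ (χ x • ofRep V A x₀ x w) = _
  rw [map_smul]
  exact congrArg _ (map_symm_ofRep hx w)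

variable [FiniteDimensional ℝ EM] [IsManifold 𝓘(ℝ, EM) ∞ M] [T2Space M]

include hχ in
/-- An odd vector field on `ΠA` is a first order operator: its value at `x` on a function vanishing
to first order at `x` is zero. -/
theorem evalAt_eq_zero_of_jet (s : Functions A EM V (id : M → M)) {x : M} (hχx : χ x = 1)
    (hs : ∀ ℓ : Module.Dual ℝ (ExteriorAlgebra ℝ (Module.Dual ℝ V)),
      ℓ (fixedRep V x₀ s.1 x) = 0 ∧
      HasDer (fun y => ℓ (fixedRep V x₀ s.1 y)) x (0 : EM →L[ℝ] ℝ)) :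
    evalAt x (D s) = 0 := by
  have hx : x ∈ (trivializationAt V A x₀).baseSet :=
    hχ (subset_tsupport _ (by rw [Function.mem_support, hχx]; exact one_ne_zero))
  let b := Module.finBasis ℝ (ExteriorAlgebra ℝ (Module.Dual ℝ V))
  have ha : ∀ i, ContMDiff 𝓘(ℝ, EM) 𝓘(ℝ, ℝ) ∞
      (fun y => χ y * b.coord i (fixedRep V x₀ s.1 y)) := by
    intro i y
    by_cases hy : y ∈ (trivializationAt V A x₀).baseSet
    · exact (χ.contMDiff y).mul (s.2.componentsSmoothAt_fixedRep contMDiff_id hy (b.coord i))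
    · refine (contMDiffAt_const (c := (0 : ℝ))).congr_of_eventuallyEq ?_
      filter_upwards [notMem_tsupport_iff_eventuallyEq.1 fun h => hy (hχ h)] with z hz
      simp [hz]
  let a : Fin (Module.finrank ℝ (ExteriorAlgebra ℝ (Module.Dual ℝ V))) →
    C^∞⟮𝓘(ℝ, EM), M; 𝓘(ℝ, ℝ), ℝ⟯ := fun i => ⟨_, ha i⟩
  -- One factor `χ` makes the coefficients of `s` global functions, the other makes the frame
  -- global; hence the square.
  have hexp : scalar (χ * χ) * s = ∑ i, scalar (a i) * frame A x₀ χ hχ (b i) := by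
    ext y ⟨y', hy'⟩
    obtain rfl : y' = y := hy'
    change evalAt y' (scalar (χ * χ) * s) =
      evalAt y' (∑ i, scalar (a i) * frame A x₀ χ hχ (b i))
    have hl : ∀ (c : C^∞⟮𝓘(ℝ, EM), M; 𝓘(ℝ, ℝ), ℝ⟯) (r : Functions A EM V (id : M → M)),
        evalAt y' (scalar c * r) = c y' • evalAt y' r := fun c r => by
      rw [map_mul, evalAt_scalar, ← Algebra.smul_def]
    simp only [map_sum, hl, evalAt_frame, smul_smul]
    by_cases hy : y' ∈ (trivializationAt V A x₀).baseSet
    · have h1 : evalAt y' s = ofRep V A x₀ y' (fixedRep V x₀ s.1 y') :=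
        (ofRep_fixedRep x₀ s.1 hy).symm
      rw [h1]
      conv_lhs => rw [← b.sum_repr (fixedRep V x₀ s.1 y')]
      simp only [map_sum, map_smul, Finset.smul_sum, smul_smul]
      refine Finset.sum_congr rfl fun i _ => ?_
      congr 1
      change χ y' * χ y' * _ = χ y' * b.coord i (fixedRep V x₀ s.1 y') * χ y'
      rw [Module.Basis.coord_apply]
      ring
    · have h0 : χ y' = 0 := image_eq_zero_of_notMem_tsupport fun h => hy (hχ h)
      simp [h0]
  have hs0 : evalAt x s = 0 := by
    have h0 : fixedRep V x₀ s.1 x = 0 := (Module.forall_dual_apply_eq_zero_iff ℝ _).1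
      fun ℓ => (hs ℓ).1
    have h1 := ofRep_fixedRep (V := V) x₀ s.1 (q := x) hx
    rw [h0, map_zero] at h1
    exact h1.symm
  -- As `s` vanishes at `x`, the term with the derivative of `χ * χ` drops out, so the cut-off does
  -- not change the value at `x`.
  have h1 := evalAt_scalar_mul D x (χ * χ) s
  rw [hs0, mul_zero, zero_add, ContMDiffMap.coe_mul, Pi.mul_apply, hχx, one_mul, one_smul] at h1
  rw [← h1, hexp]
  change evalAt x (D.toLinearMap _) = 0
  rw [map_sum, map_sum]
  refine Finset.sum_eq_zero fun i _ => ?_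
  have hax : a i x = 0 := by
    change χ x * b.coord i (fixedRep V x₀ s.1 x) = 0
    rw [(hs (b.coord i)).1, mul_zero]
  have hda : HasDer (a i) x (0 : EM →L[ℝ] ℝ) := by
    have := (hasDer_der (χ.contMDiff x)).mul (hs (b.coord i)).2
    rw [(hs (b.coord i)).1, smul_zero, zero_smul, add_zero] at this
    exact this
  have h2 := evalAt_scalar_mul D x (a i) (frame A x₀ χ hχ (b i))
  rw [pointDerivation_eq_zero x (scalarDer D x) (scalarDer_mul D x) (a i) hax hda, hax, zero_mul,
    zero_smul, zero_add] at h2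
  exact h2

end Base

/-! ### Horizontal 1-jets and their compatibility with the algebra operations -/

section Jets

variable {EM : Type*} [NormedAddCommGroup EM] [NormedSpace ℝ EM]
  {M : Type*} [TopologicalSpace M] [ChartedSpace EM M]
  {EF : Type*} [NormedAddCommGroup EF] [NormedSpace ℝ EF]
  {F : Type*} [TopologicalSpace F] [ChartedSpace EF F]
  {V : Type*} [NormedAddCommGroup V] [NormedSpace ℝ V]
  {A : M → Type*} [∀ x, AddCommGroup (A x)] [∀ x, Module ℝ (A x)]
  [∀ x, TopologicalSpace (A x)] [TopologicalSpace (Bundle.TotalSpace V A)]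
  [FiberBundle V A] [VectorBundle ℝ V A] {τ : F → M}

variable (V) in
/-- The function `s` on `ΠA` and the function `f` on `τ* ΠA` have the same value and the same
horizontal derivative at `q`, with respect to the lift `H` of tangent vectors at `τ q` to `q`. -/
def JetRel (x₀ : M) (H : EM →L[ℝ] EF) (q : F) (f : PreFunction A τ)
    (s : PreFunction A (id : M → M)) : Prop :=
  ∀ ℓ : Module.Dual ℝ (ExteriorAlgebra ℝ (Module.Dual ℝ V)), ∃ T : EF →L[ℝ] ℝ,
    HasDer (fun p => ℓ (fixedRep V x₀ f p)) q T ∧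
    HasDer (fun y => ℓ (fixedRep V x₀ s y)) (τ q) (T.comp H) ∧
    ℓ (fixedRep V x₀ s (τ q)) = ℓ (fixedRep V x₀ f q)

variable {x₀ : M} {H : EM →L[ℝ] EF} {q : F} {f g : PreFunction A τ}
  {s r : PreFunction A (id : M → M)}

theorem JetRel.add (hf : JetRel V x₀ H q f s) (hg : JetRel V x₀ H q g r) :
    JetRel V x₀ H q (f + g) (s + r) := fun ℓ => by
  obtain ⟨T, h1, h2, h3⟩ := hf ℓ
  obtain ⟨T', h1', h2', h3'⟩ := hg ℓ
  refine ⟨T + T', ?_, ?_, ?_⟩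
  · simp only [fixedRep_add, map_add]
    exact h1.add h1'
  · simp only [fixedRep_add, map_add, ContinuousLinearMap.add_comp]
    exact h2.add h2'
  · simp only [fixedRep_add, map_add, h3, h3']

theorem JetRel.smul (c : ℝ) (hf : JetRel V x₀ H q f s) :
    JetRel V x₀ H q (c • f) (c • s) := fun ℓ => by
  obtain ⟨T, h1, h2, h3⟩ := hf (c • ℓ)
  refine ⟨T, ?_, ?_, ?_⟩
  · simp only [fixedRep_smul, map_smul]
    exact h1
  · simp only [fixedRep_smul, map_smul]
    exact h2
  · simp only [fixedRep_smul, map_smul]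
    exact h3

theorem JetRel.scale (t : ℝ) (hf : JetRel V x₀ H q f s) :
    JetRel V x₀ H q (fun x p => ExteriorAlgebra.map (t • LinearMap.id) (f x p))
      (fun x p => ExteriorAlgebra.map (t • LinearMap.id) (s x p)) := fun ℓ => by
  obtain ⟨T, h1, h2, h3⟩ := hf (ℓ ∘ₗ (ExteriorAlgebra.map (t • LinearMap.id)).toLinearMap)
  refine ⟨T, ?_, ?_, ?_⟩
  · simp only [fixedRep_scale]
    exact h1
  · simp only [fixedRep_scale]
    exact h2
  · simp only [fixedRep_scale]
    exact h3

/-- The ordinary product rule, carried through the structure constants of the exterior algebra in a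
basis. Parity signs play no role, as only base directions are differentiated. -/
theorem JetRel.mul [FiniteDimensional ℝ V] (hf : JetRel V x₀ H q f s)
    (hg : JetRel V x₀ H q g r) : JetRel V x₀ H q (f * g) (s * r) := fun ℓ => by
  let b := Module.finBasis ℝ (ExteriorAlgebra ℝ (Module.Dual ℝ V))
  choose T h1 h2 h3 using fun i => hf (b.coord i)
  choose T' h1' h2' h3' using fun i => hg (b.coord i)
  have hmul : ∀ u v, ℓ (u * v) = ∑ i, ∑ j, (b.coord i u * b.coord j v) * ℓ (b i * b j) := by
    intro u v
    conv_lhs => rw [← b.sum_repr u, ← b.sum_repr v]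
    simp only [Finset.sum_mul_sum, map_sum, smul_mul_smul_comm, map_smul, smul_eq_mul,
      Module.Basis.coord_apply]
  have hm : ∀ p, ℓ (fixedRep V x₀ (f * g) p) = ∑ i, ∑ j,
      (b.coord i (fixedRep V x₀ f p) * b.coord j (fixedRep V x₀ g p)) * ℓ (b i * b j) :=
    fun p => by rw [fixedRep_mul, hmul]
  have hm' : ∀ y, ℓ (fixedRep V x₀ (s * r) y) = ∑ i, ∑ j,
      (b.coord i (fixedRep V x₀ s y) * b.coord j (fixedRep V x₀ r y)) * ℓ (b i * b j) :=
    fun y => by rw [fixedRep_mul, hmul]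
  refine ⟨∑ i, ∑ j, ℓ (b i * b j) • (b.coord i (fixedRep V x₀ f q) • T' j +
    b.coord j (fixedRep V x₀ g q) • T i), ?_, ?_, ?_⟩
  · simp only [hm]
    exact HasDer.sum fun i _ => HasDer.sum fun j _ => ((h1 i).mul (h1' j)).mul_const _
  · simp only [hm']
    have h := HasDer.sum (t := Finset.univ) fun i _ => HasDer.sum (t := Finset.univ)
      fun j _ => ((h2 i).mul (h2' j)).mul_const (ℓ (b i * b j))
    simp only [h3, h3'] at h
    convert h using 1
    ext v
    simp [sum_apply]
  · simp only [hm, hm', h3, h3']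

end Jets

/-! ### Local connections, and functions on `ΠA` with prescribed horizontal jet -/

section LocalConnection

variable {EM : Type*} [NormedAddCommGroup EM] [NormedSpace ℝ EM]
  {M : Type*} [TopologicalSpace M] [ChartedSpace EM M]
  {EF : Type*} [NormedAddCommGroup EF] [NormedSpace ℝ EF]
  {F : Type*} [TopologicalSpace F] [ChartedSpace EF F]
  {V : Type*} [NormedAddCommGroup V] [NormedSpace ℝ V] [FiniteDimensional ℝ V]
  {A : M → Type*} [∀ x, AddCommGroup (A x)] [∀ x, Module ℝ (A x)]
  [∀ x, TopologicalSpace (A x)] [TopologicalSpace (Bundle.TotalSpace V A)]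
  [FiberBundle V A] [VectorBundle ℝ V A]

/-- A weighted connection over the part of the total space above `U`; nothing is required
elsewhere. -/
structure IsLocalConnection (B : GradedBundle EM M EF F) (L : LieAlgebroid EM V A) (U : Set M)
    (N : Functions A EF V B.proj → PreFunction A B.proj) : Prop where
  smooth : ∀ f q, B.proj q ∈ U → ComponentsSmoothAt EF (localRep V (N f) q) q
  add : ∀ f g, ∀ x ∈ U, ∀ q, N (f + g) x q = N f x q + N g x q
  smul : ∀ (c : ℝ) f, ∀ x ∈ U, ∀ q, N (c • f) x q = c • N f x q
  leibniz : ∀ f g, ∀ x ∈ U, ∀ q,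
    N (f * g) x q = N f x q * g.1 x q + (parity f).1 x q * N g x q
  act : ∀ t f, ∀ x ∈ U, ∀ q,
    N f x ⟨B.act t q.1, (B.proj_act t q.1).trans q.2⟩ = N (baseScale B t f) x q
  scale : ∀ t f, ∀ x ∈ U, ∀ q,
    ExteriorAlgebra.map (t • LinearMap.id) (N f x q) = t • N (fibreScale t f) x q
  proj : ∀ s, ∀ x ∈ U, ∀ q, N (projPullback B s) x q = evalAt x (L.d s)

variable [ContMDiffVectorBundle ∞ V A 𝓘(ℝ, EM)]

section JetDetermined

variable {τ : F → M} {x₀ : M} {H : EM →L[ℝ] EF} {q : F}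
  {χ : C^∞⟮𝓘(ℝ, EM), M; 𝓘(ℝ, ℝ), ℝ⟯}
  [FiniteDimensional ℝ EM] [IsManifold 𝓘(ℝ, EM) ∞ M] [T2Space M]

/-- The difference of `s` and `r` vanishes to first order at `τ q`, since the derivative of `f` is
unique. This is the source of all the algebraic identities of the local lift. -/
theorem JetRel.evalAt_eq {f : PreFunction A τ} {s r : Functions A EM V (id : M → M)}
    (hχ : tsupport χ ⊆ (trivializationAt V A x₀).baseSet) (hχx : χ (τ q) = 1)
    (D : OddVectorField A EM V (id : M → M))
    (hs : JetRel V x₀ H q f s.1) (hr : JetRel V x₀ H q f r.1) :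
    evalAt (τ q) (D s) = evalAt (τ q) (D r) := by
  have h : evalAt (τ q) (D (s + (-1 : ℝ) • r)) = 0 := by
    refine evalAt_eq_zero_of_jet D hχ _ hχx fun ℓ => ?_
    obtain ⟨T, h1, h2, h3⟩ := hs ℓ
    obtain ⟨T', h1', h2', h3'⟩ := hr ℓ
    obtain rfl : T = T' := h1.unique h1'
    have e : ∀ y, ℓ (fixedRep V x₀ (s + (-1 : ℝ) • r).1 y) =
        ℓ (fixedRep V x₀ s.1 y) + ℓ (fixedRep V x₀ r.1 y) * (-1) := by
      intro y
      have : (s + (-1 : ℝ) • r).1 = s.1 + (-1 : ℝ) • r.1 := rfl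
      rw [this, fixedRep_add, fixedRep_smul, map_add, map_smul, smul_eq_mul, mul_comm]
    simp only [e]
    refine ⟨by rw [h3, h3']; ring, ?_⟩
    have := h2.add (h2'.mul_const (-1))
    have e0 : T.comp H + (-1 : ℝ) • T.comp H = 0 := by
      ext v
      simp
    exact e0 ▸ this
  have h' : D (s + (-1 : ℝ) • r) = D s + (-1 : ℝ) • D r := by
    rw [map_add, map_smul]
  rw [h', map_add, map_smul, neg_one_smul, ← sub_eq_add_neg] at h
  exact sub_eq_zero.1 h

end JetDetermined

namespace GradedBundle

variable (B : GradedBundle EM M EF F) {Φ : F → EF}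
  (hΦ : ContMDiff 𝓘(ℝ, EF) 𝓘(ℝ, EF) ∞ Φ)
  {x₀ : M} {χ : C^∞⟮𝓘(ℝ, EM), M; 𝓘(ℝ, ℝ), ℝ⟯}
  (hχ : tsupport χ ⊆ (trivializationAt V A x₀).baseSet)

/-- The components of a function on `τ* ΠA` in the local trivialization at `x₀`. -/
def component (x₀ : M) (f : PreFunction A B.proj)
    (i : Fin (Module.finrank ℝ (ExteriorAlgebra ℝ (Module.Dual ℝ V)))) (q : F) : ℝ :=
  (Module.finBasis ℝ (ExteriorAlgebra ℝ (Module.Dual ℝ V))).coord i (fixedRep V x₀ f q)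

/-- The differential of a component, in the local coordinates `Φ`. -/
def componentDer (Φ : F → EF) (x₀ : M) (f : PreFunction A B.proj)
    (i : Fin (Module.finrank ℝ (ExteriorAlgebra ℝ (Module.Dual ℝ V)))) (q : F) : EF →L[ℝ] ℝ :=
  (der (B.component x₀ f i) q : EF →L[ℝ] ℝ).comp (der Φ q : EF →L[ℝ] EF).inverse

/-- The function on the base with the same horizontal 1-jet at `q` as a component of `f`. -/
def jetCoefficient (x₀ : M) (f : PreFunction A B.proj)
    (i : Fin (Module.finrank ℝ (ExteriorAlgebra ℝ (Module.Dual ℝ V)))) (q : F) :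
    C^∞⟮𝓘(ℝ, EM), M; 𝓘(ℝ, ℝ), ℝ⟯ :=
  -- Affine in `Φ ∘ incl`; the constant restores the value at `proj q`, because `q` itself need not
  -- lie on the zero section.
  ⟨fun y => B.componentDer Φ x₀ f i q (Φ (B.incl y)) + (B.component x₀ f i q -
      B.componentDer Φ x₀ f i q (Φ (B.incl (B.proj q)))),
    ((B.componentDer Φ x₀ f i q).contDiff.contMDiff.comp (hΦ.comp B.contMDiff_incl)).add
      contMDiff_const⟩

/-- A function on `ΠA` with the same horizontal 1-jet at `q` as `f`. -/
def jetSection (f : PreFunction A B.proj) (q : F) : Functions A EM V (id : M → M) :=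
  ∑ i, scalar (B.jetCoefficient hΦ x₀ f i q) *
    frame A x₀ χ hχ (Module.finBasis ℝ (ExteriorAlgebra ℝ (Module.Dual ℝ V)) i)

/-- At `proj q` the derivative of a coefficient is `dc ∘ (dΦ)⁻¹ ∘ d(Φ ∘ incl)`, which is `dc ∘ H` by
definition of `H`. Having `χ = 1` on a neighbourhood keeps the cut-off out of the derivative. -/
theorem jetRel_jetSection {f : Functions A EF V B.proj} {q : F}
    (hχq : χ =ᶠ[nhds (B.proj q)] 1) :
    JetRel V x₀ (B.horizontalLift Φ q) q f.1 (B.jetSection hΦ hχ f.1 q).1 := by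
  intro ℓ
  let b := Module.finBasis ℝ (ExteriorAlgebra ℝ (Module.Dual ℝ V))
  have hbase : B.proj q ∈ (trivializationAt V A x₀).baseSet :=
    hχ (subset_tsupport _ (by rw [Function.mem_support, hχq.eq_of_nhds]; exact one_ne_zero))
  have hc : ∀ i, HasDer (B.component x₀ f.1 i) q (der (B.component x₀ f.1 i) q : EF →L[ℝ] ℝ) :=
    fun i => hasDer_der (f.2.componentsSmoothAt_fixedRep B.contMDiff_proj hbase (b.coord i))
  have hf : ∀ p, ℓ (fixedRep V x₀ f.1 p) = ∑ i, B.component x₀ f.1 i p * ℓ (b i) := by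
    intro p
    conv_lhs => rw [← b.sum_repr (fixedRep V x₀ f.1 p)]
    simp only [map_sum, map_smul, smul_eq_mul]
    rfl
  have hs : ∀ y, y ∈ (trivializationAt V A x₀).baseSet → χ y = 1 →
      ℓ (fixedRep V x₀ (B.jetSection hΦ hχ f.1 q).1 y) =
        ∑ i, B.jetCoefficient hΦ x₀ f.1 i q y * ℓ (b i) := by
    intro y hy hy1
    have e : (B.jetSection hΦ hχ f.1 q).1 = ∑ i, ((scalar (B.jetCoefficient hΦ x₀ f.1 i q) :
        Functions A EM V (id : M → M)).1 * (frame A x₀ χ hχ (b i)).1) := by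
      simp only [jetSection, AddSubmonoidClass.coe_finsetSum, MulMemClass.coe_mul, b]
    have e2 : fixedRep V x₀ (B.jetSection hΦ hχ f.1 q).1 y =
        ∑ i, B.jetCoefficient hΦ x₀ f.1 i q y • b i := by
      rw [e]
      have : ∀ u : PreFunction A (id : M → M), fixedRep V x₀ u y =
        (((ExteriorAlgebra.map ((trivializationAt V A x₀).symmₗ ℝ y).dualMap).comp
          (Pi.evalAlgHom ℝ _ (⟨y, rfl⟩ : {p : M // id p = y}))).comp
            (Pi.evalAlgHom ℝ _ y)) u := fun _ => rfl
      rw [this, map_sum]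
      refine Finset.sum_congr rfl fun i _ => ?_
      rw [← this, fixedRep_mul, fixedRep_scalar, fixedRep_frame hχ hy, hy1, one_smul,
        Algebra.smul_def]
    rw [e2]
    simp only [map_sum, map_smul, smul_eq_mul]
  refine ⟨∑ i, ℓ (b i) • (der (B.component x₀ f.1 i) q : EF →L[ℝ] ℝ), ?_, ?_, ?_⟩
  · simp only [hf]
    exact HasDer.sum fun i _ => (hc i).mul_const _
  · have hz : HasDer (fun y => Φ (B.incl y)) (B.proj q)
        (der (fun y => Φ (B.incl y)) (B.proj q) : EM →L[ℝ] EF) :=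
      hasDer_der ((hΦ.comp B.contMDiff_incl) _)
    have h := HasDer.sum (t := Finset.univ) fun i _ =>
      ((hasDer_clm_comp (B.componentDer Φ x₀ f.1 i q) hz).add
        (hasDer_const (B.component x₀ f.1 i q -
          B.componentDer Φ x₀ f.1 i q (Φ (B.incl (B.proj q)))) (B.proj q))).mul_const (ℓ (b i))
    have h' := h.congr (g := fun y => ℓ (fixedRep V x₀ (B.jetSection hΦ hχ f.1 q).1 y)) (by
      filter_upwards [hχq, (trivializationAt V A x₀).open_baseSet.mem_nhds hbase] with y hy hy'
      exact hs y hy' hy)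
    convert h' using 1
    ext v
    simp [sum_apply, componentDer, horizontalLift]
  · rw [hs _ hbase hχq.eq_of_nhds, hf]
    refine Finset.sum_congr rfl fun i _ => ?_
    congr 1
    change B.componentDer Φ x₀ f.1 i q (Φ (B.incl (B.proj q))) + (B.component x₀ f.1 i q -
      B.componentDer Φ x₀ f.1 i q (Φ (B.incl (B.proj q)))) = B.component x₀ f.1 i q
    ring

variable (Φ) in
/-- The coordinates of the linearization `Φ`, restricted to the base. -/
def coordinate (k : Fin (Module.finrank ℝ EF)) [FiniteDimensional ℝ EF] :
    C^∞⟮𝓘(ℝ, EM), M; 𝓘(ℝ, ℝ), ℝ⟯ :=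
  ⟨fun y => ((Module.finBasis ℝ EF).coord k).toContinuousLinearMap (Φ (B.incl y)),
    ((Module.finBasis ℝ EF).coord k).toContinuousLinearMap.contDiff.contMDiff.comp
      (hΦ.comp B.contMDiff_incl)⟩

end GradedBundle

end LocalConnection

/-! ### The local lift of `d_A` -/

namespace GradedBundle

variable {EM : Type*} [NormedAddCommGroup EM] [NormedSpace ℝ EM]
  {M : Type*} [TopologicalSpace M] [ChartedSpace EM M]
  {EF : Type*} [NormedAddCommGroup EF] [NormedSpace ℝ EF] [FiniteDimensional ℝ EF]
  {F : Type*} [TopologicalSpace F] [ChartedSpace EF F] [IsManifold 𝓘(ℝ, EF) ∞ F]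
  {V : Type*} [NormedAddCommGroup V] [NormedSpace ℝ V] [FiniteDimensional ℝ V]
  {A : M → Type*} [∀ x, AddCommGroup (A x)] [∀ x, Module ℝ (A x)]
  [∀ x, TopologicalSpace (A x)] [TopologicalSpace (Bundle.TotalSpace V A)]
  [FiberBundle V A] [VectorBundle ℝ V A] [ContMDiffVectorBundle ∞ V A 𝓘(ℝ, EM)]
  (B : GradedBundle EM M EF F) {Φ : F → EF} {Λ : ℝ → (EF →L[ℝ] EF)}
  (hΦ : ContMDiff 𝓘(ℝ, EF) 𝓘(ℝ, EF) ∞ Φ) (hΛ : ∀ t q, Φ (B.act t q) = Λ t (Φ q))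
  {x₀ : M} {χ : C^∞⟮𝓘(ℝ, EM), M; 𝓘(ℝ, ℝ), ℝ⟯}
  (hχ : tsupport χ ⊆ (trivializationAt V A x₀).baseSet)

-- The pullback has derivative `ds ∘ dτ`, and `dτ ∘ H` is the identity.
include hΦ hΛ in
theorem jetRel_projPullback (s : Functions A EM V (id : M → M)) {q : F}
    (hbase : B.proj q ∈ (trivializationAt V A x₀).baseSet)
    (hq : (der Φ (B.incl (B.proj q)) : EF →L[ℝ] EF).IsInvertible) :
    JetRel V x₀ (B.horizontalLift Φ q) q (projPullback B s).1 s.1 := by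
  intro ℓ
  have h1 : HasDer (fun y => ℓ (fixedRep V x₀ s.1 y)) (B.proj q)
      (der (fun y => ℓ (fixedRep V x₀ s.1 y)) (B.proj q) : EM →L[ℝ] ℝ) :=
    hasDer_der (s.2.componentsSmoothAt_fixedRep contMDiff_id hbase ℓ)
  have h2 : HasDer B.proj q (der B.proj q : EF →L[ℝ] EM) := hasDer_der (B.contMDiff_proj q)
  have h3 := HasDer.comp (g := fun y => ℓ (fixedRep V x₀ s.1 y)) h1 h2
  refine ⟨_, h3, ?_, rfl⟩
  rw [ContinuousLinearMap.comp_assoc, B.der_proj_comp_horizontalLift hΦ hΛ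
    (B.isInvertible_der_of_incl hΦ hΛ hq) hq, ContinuousLinearMap.comp_id]
  exact h1

omit [FiniteDimensional ℝ EF] [IsManifold 𝓘(ℝ, EF) ∞ F]
  [ContMDiffVectorBundle ∞ V A 𝓘(ℝ, EM)] in
theorem fixedRep_baseScale (f : Functions A EF V B.proj) (t : ℝ) (q : F) :
    fixedRep V x₀ (baseScale B t f).1 q = fixedRep V x₀ f.1 (B.act t q) :=
  (fixedRep_eq x₀ f.1 (B.act t q) (B.proj_act t q)).symm

-- The derivative of the pullback is `T ∘ dh_t`, and `dh_t ∘ H` at `q` is the lift at `h_t q`; the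
-- base point is unchanged.
omit [ContMDiffVectorBundle ∞ V A 𝓘(ℝ, EM)] in
include hΦ hΛ in
theorem jetRel_baseScale {f : Functions A EF V B.proj} {s : Functions A EM V (id : M → M)}
    (t : ℝ) {q : F} (hq : (der Φ (B.incl (B.proj q)) : EF →L[ℝ] EF).IsInvertible)
    (h : JetRel V x₀ (B.horizontalLift Φ (B.act t q)) (B.act t q) f.1 s.1) :
    JetRel V x₀ (B.horizontalLift Φ q) q (baseScale B t f).1 s.1 := by
  intro ℓ
  obtain ⟨T, h1, h2, h3⟩ := h ℓ
  have h4 : HasDer (B.act t) q (der (B.act t) q : EF →L[ℝ] EF) :=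
    hasDer_der (B.contMDiff_act_apply t q)
  refine ⟨T.comp (der (B.act t) q : EF →L[ℝ] EF), ?_, ?_, ?_⟩
  · simp only [fixedRep_baseScale]
    exact HasDer.comp (g := fun p => ℓ (fixedRep V x₀ f.1 p)) h1 h4
  · rw [ContinuousLinearMap.comp_assoc, B.der_act_comp_horizontalLift hΦ hΛ t
      (B.isInvertible_der_of_incl hΦ hΛ hq)
      (B.isInvertible_der_of_incl hΦ hΛ (by rwa [B.proj_act])), ← B.proj_act t q]
    exact h2
  · rw [fixedRep_baseScale, ← B.proj_act t q]
    exact h3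

-- Separates variables: `q` enters only through numerical factors, while the differentiated
-- functions `coordinate` do not depend on `q`. Constants are killed by the derivation.
omit [IsManifold 𝓘(ℝ, EF) ∞ F] [ContMDiffVectorBundle ∞ V A 𝓘(ℝ, EM)] in
theorem scalarDer_jetCoefficient (D : OddVectorField A EM V (id : M → M))
    (f : PreFunction A B.proj)
    (i : Fin (Module.finrank ℝ (ExteriorAlgebra ℝ (Module.Dual ℝ V)))) (q : F) (x : M) :
    scalarDer D x (B.jetCoefficient hΦ x₀ f i q) =
      ∑ k, B.componentDer Φ x₀ f i q (Module.finBasis ℝ EF k) •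
        scalarDer D x (B.coordinate Φ hΦ k) := by
  have h : B.jetCoefficient hΦ x₀ f i q =
      ∑ k, B.componentDer Φ x₀ f i q (Module.finBasis ℝ EF k) • B.coordinate Φ hΦ k +
        (B.component x₀ f i q - B.componentDer Φ x₀ f i q (Φ (B.incl (B.proj q)))) •
          (1 : C^∞⟮𝓘(ℝ, EM), M; 𝓘(ℝ, ℝ), ℝ⟯) := by
    ext y
    have e : B.componentDer Φ x₀ f i q (Φ (B.incl y)) = ∑ k,
        B.componentDer Φ x₀ f i q (Module.finBasis ℝ EF k) * B.coordinate Φ hΦ k y := by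
      conv_lhs => rw [← (Module.finBasis ℝ EF).sum_repr (Φ (B.incl y))]
      rw [map_sum]
      refine Finset.sum_congr rfl fun k _ => ?_
      rw [map_smul, smul_eq_mul, mul_comm]
      rfl
    have e' : ∀ (s : Finset (Fin (Module.finrank ℝ EF)))
        (u : Fin (Module.finrank ℝ EF) → C^∞⟮𝓘(ℝ, EM), M; 𝓘(ℝ, ℝ), ℝ⟯),
        (∑ k ∈ s, u k) y = ∑ k ∈ s, u k y := by
      intro s u
      exact map_sum ((Pi.evalAddMonoidHom (fun _ : M => ℝ) y).comp
        (ContMDiffMap.coeFnAddMonoidHom (I := 𝓘(ℝ, EM)) (I' := 𝓘(ℝ, ℝ)) (n := ∞))) u s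
    change B.componentDer Φ x₀ f i q (Φ (B.incl y)) + _ = _
    rw [ContMDiffMap.coe_add, Pi.add_apply, e', e]
    congr 1
    simp
  rw [h, map_add, map_smul, scalarDer_one, smul_zero, add_zero, map_sum]
  simp only [map_smul]

omit [IsManifold 𝓘(ℝ, EF) ∞ F] in
theorem evalAt_jetSection (D : OddVectorField A EM V (id : M → M))
    (f : PreFunction A B.proj) (q : F) :
    evalAt (B.proj q) (D (B.jetSection hΦ hχ f q)) =
      ∑ i, ((∑ k, B.componentDer Φ x₀ f i q (Module.finBasis ℝ EF k) •
          evalAt (B.proj q) (D (scalar (B.coordinate Φ hΦ k)))) *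
          evalAt (B.proj q) (frame A x₀ χ hχ (Module.finBasis ℝ _ i)) +
        B.component x₀ f i q •
          evalAt (B.proj q) (D (frame A x₀ χ hχ (Module.finBasis ℝ _ i)))) := by
  rw [jetSection, map_sum, map_sum]
  refine Finset.sum_congr rfl fun i _ => ?_
  rw [evalAt_scalar_mul, scalarDer_jetCoefficient]
  congr 2
  change B.componentDer Φ x₀ f i q (Φ (B.incl (B.proj q))) + (B.component x₀ f i q -
      B.componentDer Φ x₀ f i q (Φ (B.incl (B.proj q)))) = B.component x₀ f i q
  ring

/-- The lift of `d_A` by the flat connection of the linearization `Φ`. -/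
def localLift (L : LieAlgebroid EM V A) (f : Functions A EF V B.proj) : PreFunction A B.proj :=
  fun x q => evalAt x (L.d (B.jetSection hΦ hχ f.1 q.1))

/-- `localLift` uses a different function on `ΠA` at each `q`. The formula of `evalAt_jetSection`
rewrites it through finitely many fixed functions on `ΠA`, with coefficients smooth in `q` by
`contMDiffAt_der_comp_inverse`. -/
theorem componentsSmoothAt_localLift (L : LieAlgebroid EM V A) (f : Functions A EF V B.proj)
    {q₀ : F} (hbase : B.proj q₀ ∈ (trivializationAt V A x₀).baseSet)
    (h₀ : (der Φ q₀ : EF →L[ℝ] EF).IsInvertible) :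
    ComponentsSmoothAt EF (localRep V (B.localLift hΦ hχ L f) q₀) q₀ := by
  have hs : ∀ s : Functions A EM V (id : M → M),
      ComponentsSmoothAt EF (fun q => fixedRep V x₀ s.1 (B.proj q)) q₀ := fun s =>
    (projPullback B s).2.componentsSmoothAt_fixedRep B.contMDiff_proj hbase
  have hcomp : ∀ i, ∀ᶠ q in nhds q₀,
      ContMDiffAt 𝓘(ℝ, EF) 𝓘(ℝ, ℝ) ∞ (B.component (V := V) x₀ f.1 i) q := by
    intro i
    filter_upwards [B.contMDiff_proj.continuous.continuousAt.eventually
      ((trivializationAt V A x₀).open_baseSet.mem_nhds hbase)] with q hq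
    exact f.2.componentsSmoothAt_fixedRep B.contMDiff_proj hq _
  refine componentsSmoothAt_fixedRep_change (x₀ := x₀) (x₁ := B.proj q₀) (B.contMDiff_proj q₀)
    hbase (FiberBundle.mem_baseSet_trivializationAt' (F := V) _) ?_
  have h : fixedRep V x₀ (B.localLift hΦ hχ L f) = fun q =>
      ∑ i, ((∑ k, B.componentDer Φ x₀ f.1 i q (Module.finBasis ℝ EF k) •
          fixedRep V x₀ (L.d (scalar (B.coordinate Φ hΦ k))).1 (B.proj q)) *
          fixedRep V x₀ (frame A x₀ χ hχ (Module.finBasis ℝ _ i)).1 (B.proj q) +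
        B.component x₀ f.1 i q •
          fixedRep V x₀ (L.d (frame A x₀ χ hχ (Module.finBasis ℝ _ i))).1 (B.proj q)) := by
    funext q
    have e := congrArg (ExteriorAlgebra.map
      ((trivializationAt V A x₀).symmₗ ℝ (B.proj q)).dualMap)
      (B.evalAt_jetSection hΦ hχ L.d f.1 q)
    simp only [map_sum, map_add, map_mul, map_smul] at e
    exact e
  rw [h]
  refine .sum fun i _ => .add (.mul (.sum fun k _ => .smul ?_ (hs _)) (hs _))
    (.smul (hcomp i).self_of_nhds (hs _))
  have hd := contMDiffAt_der_comp_inverse hΦ (hcomp i) h₀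
  exact hd.clm_apply contMDiffAt_const

variable [FiniteDimensional ℝ EM] [IsManifold 𝓘(ℝ, EM) ∞ M] [T2Space M]

/-- Apart from smoothness, each condition compares `d_A` on two functions on `ΠA` with the same
horizontal jet at `q`, and the corresponding property of `d_A` does the rest. -/
theorem isLocalConnection_localLift (L : LieAlgebroid EM V A) {U : Set M}
    (hU : ∀ x ∈ U, χ =ᶠ[nhds x] 1 ∧ (der Φ (B.incl x) : EF →L[ℝ] EF).IsInvertible)
    (hΛ : ∀ t q, Φ (B.act t q) = Λ t (Φ q)) :
    IsLocalConnection B L U (B.localLift hΦ hχ L) := by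
  have hone : ∀ x ∈ U, χ x = 1 := fun x hx => (hU x hx).1.eq_of_nhds
  have hbase : ∀ x ∈ U, x ∈ (trivializationAt V A x₀).baseSet := fun x hx =>
    hχ (subset_tsupport _ (by rw [Function.mem_support, hone x hx]; exact one_ne_zero))
  have hjet : ∀ (f : Functions A EF V B.proj) (q : F), B.proj q ∈ U →
      JetRel V x₀ (B.horizontalLift Φ q) q f.1 (B.jetSection hΦ hχ f.1 q).1 :=
    fun f q hq => B.jetRel_jetSection hΦ hχ (hU _ hq).1
  constructor
  · exact fun f q hq => B.componentsSmoothAt_localLift hΦ hχ L f (hbase _ hq)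
      (B.isInvertible_der_of_incl hΦ hΛ (hU _ hq).2)
  · rintro f g _ hx ⟨q, rfl⟩
    refine (JetRel.evalAt_eq hχ (hone _ hx) L.d (hjet (f + g) q hx)
      (r := B.jetSection hΦ hχ f.1 q + B.jetSection hΦ hχ g.1 q)
      ((hjet f q hx).add (hjet g q hx))).trans ?_
    rw [map_add, map_add]
    rfl
  · rintro c f _ hx ⟨q, rfl⟩
    refine (JetRel.evalAt_eq hχ (hone _ hx) L.d (hjet (c • f) q hx)
      (r := c • B.jetSection hΦ hχ f.1 q) ((hjet f q hx).smul c)).trans ?_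
    rw [map_smul, map_smul]
    rfl
  · rintro f g _ hx ⟨q, rfl⟩
    refine (JetRel.evalAt_eq hχ (hone _ hx) L.d (hjet (f * g) q hx)
      (r := B.jetSection hΦ hχ f.1 q * B.jetSection hΦ hχ g.1 q)
      ((hjet f q hx).mul (hjet g q hx))).trans ?_
    -- The Leibniz rule for `d_A` also involves the undifferentiated factors, so the values must be
    -- identified; parity acts pointwise and is determined by them.
    have hv : ∀ f : Functions A EF V B.proj,
        evalAt (B.proj q) (B.jetSection hΦ hχ f.1 q) = f.1 (B.proj q) ⟨q, rfl⟩ := by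
      intro f
      have h0 : fixedRep V x₀ (B.jetSection hΦ hχ f.1 q).1 (B.proj q) = fixedRep V x₀ f.1 q :=
        sub_eq_zero.1 ((Module.forall_dual_apply_eq_zero_iff ℝ _).1 fun ℓ => by
          obtain ⟨T, -, -, h⟩ := hjet f q hx ℓ
          rw [map_sub, h, sub_self])
      rw [← ofRep_fixedRep (V := V) x₀ f.1 (hbase _ hx), ← h0]
      exact (ofRep_fixedRep (τ := id) (V := V) x₀ _ (hbase _ hx)).symm
    rw [evalAt_leibniz, hv g]
    congr 2
    change ExteriorAlgebra.map _ (evalAt (B.proj q) (B.jetSection hΦ hχ f.1 q)) = _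
    rw [hv f]
    rfl
  · rintro t f _ hx ⟨q, rfl⟩
    -- The function chosen for `f` at `h_t q` also has the jet of `h_t* f` at `q`.
    exact JetRel.evalAt_eq hχ (hone _ hx) L.d
      (B.jetRel_baseScale hΦ hΛ t (hU _ hx).2 (hjet f (B.act t q) (by rwa [B.proj_act])))
      (hjet (baseScale B t f) q hx)
  · rintro t f _ hx ⟨q, rfl⟩
    have h := congrArg (evalAt (B.proj q)) (L.weight_one t (B.jetSection hΦ hχ f.1 q))
    rw [map_smul] at h
    refine h.trans (congrArg (t • ·) ?_)
    exact JetRel.evalAt_eq hχ (hone _ hx) L.d ((hjet f q hx).scale t)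
      (hjet (fibreScale t f) q hx)
  · rintro s _ hx ⟨q, rfl⟩
    exact JetRel.evalAt_eq hχ (hone _ hx) L.d (hjet (projPullback B s) q hx)
      (B.jetRel_projPullback hΦ hΛ s (hbase _ hx) (hU _ hx).2)

theorem exists_isLocalConnection [T2Space F] (L : LieAlgebroid EM V A) (x₀ : M) :
    ∃ U : Set M, IsOpen U ∧ x₀ ∈ U ∧ ∃ N, IsLocalConnection B L U N := by
  obtain ⟨Φ, Λ, hΦ, hΛ, T, hT, hinj⟩ := B.exists_linearization x₀
  obtain ⟨ρ, -, hρ⟩ := (SmoothBumpFunction.nhds_basis_tsupport (I := 𝓘(ℝ, EM)) x₀).mem_iff.1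
    ((trivializationAt V A x₀).open_baseSet.mem_nhds
      (FiberBundle.mem_baseSet_trivializationAt' x₀))
  let χ : C^∞⟮𝓘(ℝ, EM), M; 𝓘(ℝ, ℝ), ℝ⟯ := ⟨ρ, ρ.contMDiff⟩
  -- The interior is taken because jets require `χ = 1` near each point of `U`.
  refine ⟨interior {x | χ x = 1} ∩ {x | (der Φ (B.incl x) : EF →L[ℝ] EF).IsInvertible},
    isOpen_interior.inter ((isOpen_isInvertible_der hΦ).preimage B.contMDiff_incl.continuous),
    ⟨mem_interior_iff_mem_nhds.2 ρ.eventuallyEq_one, ?_⟩, B.localLift (χ := χ) hΦ hρ L,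
    B.isLocalConnection_localLift hΦ (χ := χ) hρ L
      (fun x hx => ⟨mem_interior_iff_mem_nhds.1 hx.1, hx.2⟩) hΛ⟩
  have e : (der Φ (B.incl x₀) : EF →L[ℝ] EF) = T := (hasDer_der (hΦ _)).unique hT
  rw [Set.mem_ofPred_eq, e]
  exact isInvertible_of_injective T hinj

end GradedBundle

/-! ### Gluing by a partition of unity on the base -/

variable {EM : Type*} [NormedAddCommGroup EM] [NormedSpace ℝ EM]
  {M : Type*} [TopologicalSpace M] [ChartedSpace EM M]
  {EF : Type*} [NormedAddCommGroup EF] [NormedSpace ℝ EF]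
  {F : Type*} [TopologicalSpace F] [ChartedSpace EF F]
  {V : Type*} [NormedAddCommGroup V] [NormedSpace ℝ V] [FiniteDimensional ℝ V]
  {A : M → Type*} [∀ x, AddCommGroup (A x)] [∀ x, Module ℝ (A x)]
  [∀ x, TopologicalSpace (A x)] [TopologicalSpace (Bundle.TotalSpace V A)]
  [FiberBundle V A] [VectorBundle ℝ V A]
  {B : GradedBundle EM M EF F} {L : LieAlgebroid EM V A}
  {U : M → Set M} {N : M → Functions A EF V B.proj → PreFunction A B.proj}
  (hN : ∀ j, IsLocalConnection B L (U j) (N j))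
  (ρ : SmoothPartitionOfUnity M 𝓘(ℝ, EM) M) (hρ : ρ.IsSubordinate U)

/-- The combination of local connections by a partition of unity. -/
def glue (N : M → Functions A EF V B.proj → PreFunction A B.proj)
    (ρ : SmoothPartitionOfUnity M 𝓘(ℝ, EM) M) (f : Functions A EF V B.proj) :
    PreFunction A B.proj :=
  fun x q => ∑ j ∈ ρ.finsupport x, ρ j x • N j f x q

-- Near `q₀` the sum runs over a fixed finite index set, and every `j` in it satisfies `B.proj q₀ ∈
-- tsupport (ρ j) ⊆ U j`.
include hN hρ in
theorem isSmooth_glue (f : Functions A EF V B.proj) : IsSmooth EF V (glue N ρ f) := by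
  intro q₀
  have h : localRep V (glue N ρ f) q₀ =ᶠ[nhds q₀] fun q =>
      ∑ j ∈ ρ.fintsupport (B.proj q₀), ρ j (B.proj q) • localRep V (N j f) q₀ q := by
    filter_upwards [B.contMDiff_proj.continuous.continuousAt.eventually
      (ρ.eventually_finsupport_subset (B.proj q₀))] with q hq
    simp only [localRep, glue, map_sum, map_smul]
    refine Finset.sum_subset hq fun j _ hj => ?_
    have : ρ j (B.proj q) = 0 := by
      simpa [ρ.mem_finsupport] using hj
    rw [this, zero_smul]
  refine ComponentsSmoothAt.congr (.sum fun j hj => .smul ?_ ?_) h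
  · exact (ρ j).contMDiff.contMDiffAt.comp q₀ (B.contMDiff_proj q₀)
  · exact (hN j).smooth f q₀ (hρ j ((ρ.mem_fintsupport_iff _ _).1 hj))

-- The weights `ρ j` are functions of the base point alone, so they commute with `h_t*`, `l_t*` and
-- multiplication. Only projection to `d_A` uses that they sum to 1.
include hN hρ in
theorem nonempty_weightedConnections_of_local : (weightedConnections B L).Nonempty := by
  have hU : ∀ {x j}, j ∈ ρ.finsupport x → x ∈ U j := fun {x j} hj =>
    hρ j (subset_tsupport _ ((ρ.mem_finsupport x).1 hj))
  have hone : ∀ x (w : ExteriorAlgebra ℝ (Module.Dual ℝ (A x))),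
      ∑ j ∈ ρ.finsupport x, ρ j x • w = w := fun x w => by
    rw [← Finset.sum_smul, ρ.sum_finsupport x (Set.mem_univ x), one_smul]
  let D : Functions A EF V B.proj →ₗ[ℝ] Functions A EF V B.proj :=
    { toFun := fun f => ⟨glue N ρ f, isSmooth_glue hN ρ hρ f⟩
      map_add' := fun f g => Subtype.ext <| funext fun x => funext fun q => by
        change glue N ρ (f + g) x q = glue N ρ f x q + glue N ρ g x q
        simp only [glue]
        rw [← Finset.sum_add_distrib]
        exact Finset.sum_congr rfl fun j hj => by rw [(hN j).add f g x (hU hj), smul_add]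
      map_smul' := fun c f => Subtype.ext <| funext fun x => funext fun q => by
        change glue N ρ (c • f) x q = c • glue N ρ f x q
        simp only [glue]
        rw [Finset.smul_sum]
        exact Finset.sum_congr rfl fun j hj => by
          rw [(hN j).smul c f x (hU hj), smul_comm] }
  have hscale : ∀ t f, fibreScale t (D f) = t • D (fibreScale t f) := fun t f =>
    Subtype.ext <| funext fun x => funext fun q => by
      change ExteriorAlgebra.map (t • LinearMap.id) (∑ j ∈ ρ.finsupport x, ρ j x • N j f x q) =
        t • ∑ j ∈ ρ.finsupport x, ρ j x • N j (fibreScale t f) x q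
      rw [map_sum, Finset.smul_sum]
      exact Finset.sum_congr rfl fun j hj => by
        rw [map_smul, (hN j).scale t f x (hU hj), smul_comm]
  refine ⟨⟨D, fun f => ?_, fun f g => ?_⟩, fun t f => ?_, hscale, fun s => ?_⟩
  -- Oddness is the weight condition at `t = -1`.
  · rw [parity, hscale, neg_one_smul, neg_neg]
  · refine Subtype.ext <| funext fun x => funext fun q => ?_
    change glue N ρ (f * g) x q = glue N ρ f x q * g.1 x q + (parity f).1 x q * glue N ρ g x q
    simp only [glue]
    rw [Finset.sum_mul, Finset.mul_sum, ← Finset.sum_add_distrib]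
    exact Finset.sum_congr rfl fun j hj => by
      rw [(hN j).leibniz f g x (hU hj), smul_add, smul_mul_assoc, mul_smul_comm]
  · refine Subtype.ext <| funext fun x => funext fun q => ?_
    exact Finset.sum_congr rfl fun j hj => congrArg _ ((hN j).act t f x (hU hj) q)
  · refine Subtype.ext <| funext fun x => funext fun q => ?_
    refine Eq.trans (Finset.sum_congr rfl fun j hj => by
      rw [(hN j).proj s x (hU hj)]) ((hone x (evalAt x (L.d s))).trans ?_)
    obtain ⟨q, rfl⟩ := q
    rfl

end GradedConnection

end

theorem theorem3p2
    {EM : Type*} [NormedAddCommGroup EM] [NormedSpace ℝ EM] [FiniteDimensional ℝ EM]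
    {M : Type*} [TopologicalSpace M] [ChartedSpace EM M] [IsManifold 𝓘(ℝ, EM) ∞ M]
    [T2Space M] [SecondCountableTopology M]
    {EF : Type*} [NormedAddCommGroup EF] [NormedSpace ℝ EF] [FiniteDimensional ℝ EF]
    {F : Type*} [TopologicalSpace F] [ChartedSpace EF F] [IsManifold 𝓘(ℝ, EF) ∞ F]
    [T2Space F] [SecondCountableTopology F]
    {V : Type*} [NormedAddCommGroup V] [NormedSpace ℝ V] [FiniteDimensional ℝ V]
    {A : M → Type*} [∀ x, AddCommGroup (A x)] [∀ x, Module ℝ (A x)]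
    [∀ x, TopologicalSpace (A x)] [TopologicalSpace (Bundle.TotalSpace V A)]
    [FiberBundle V A] [VectorBundle ℝ V A] [ContMDiffVectorBundle ∞ V A 𝓘(ℝ, EM)]
    (B : GradedConnection.GradedBundle EM M EF F) (L : GradedConnection.LieAlgebroid EM V A) :
    (GradedConnection.weightedConnections B L).Nonempty := by
  have : LocallyCompactSpace EM := 𝓘(ℝ, EM).locallyCompactSpace
  have : LocallyCompactSpace M := ChartedSpace.locallyCompactSpace EM M
  choose U hU hmem N hN using GradedConnection.GradedBundle.exists_isLocalConnection B L
  obtain ⟨ρ, hρ⟩ := SmoothPartitionOfUnity.exists_isSubordinate 𝓘(ℝ, EM) isClosed_univ U hU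
    fun x _ => Set.mem_iUnion_of_mem x (hmem x)
  exact GradedConnection.nonempty_weightedConnections_of_local hN ρ hρ
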